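/- **Model.** There are $C\ge 1$ identical machines and $n\ge 1$ tasks $\mathcal T=\{T_1,\dots,T_n\}$. Task $T_i$ has a value $v_i\in\mathbb R$, a demand $D_i$, a deadline $d_i$ and a parallelism bound $k_i$, where $D_i,d_i,k_i$ are positive integers; let $len_i=\lceil D_i/k_i\rceil$. Let $0=\tau_0<\tau_1<\dots<\tau_L=d$, where $\tau_1,\dots,\tau_L$ are the distinct deadlines and $d=\max_i d_i$. An allocation gives $y_i(t)\in\{0,\dots,k_i\}$ machines to $T_i$ at each integer time slot $t\in[1,d_i]$. It is a feasible schedule of $\mathcal S\subseteq\mathcal T$ if only tasks of $\mathcal S$ receive machines, $\sum_{t\le d_i}y_i(t)\ge D_i$ for all $T_i\in\mathcal S$, and $\sum_i y_i(t)\le C$ for every $t$. Social welfare maximization asks for $\mathcal S\subseteq\mathcal T$ and a feasible schedule of $\mathcal S$ with $v(\mathcal S)=\sum_{T_i\in\mathcal S}v_i$ maximum. **Boundary condition.** For $\mathcal S\subseteq\mathcal T$ and $1\le m\le L$ let $\lambda_m(\mathcal S)=\sum_{T_j\in\mathcal S}a_{j,m}$, where $a_{j,m}=0$ if $d_j\le\tau_{L-m}$;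 otherwise $a_{j,m}=D_j$ if $len_j\le d_j-\tau_{L-m}$ and $a_{j,m}=k_j(d_j-\tau_{L-m})$ if not. Let $\lambda_0^C=0$ and $\lambda_m^C=\lambda_{m-1}^C+\min\{\lambda_m-\lambda_{m-1}^C,\,C(\tau_{L-m+1}-\tau_{L-m})\}$. The set $\mathcal S$ satisfies the boundary condition if $\sum_{T_j\in\mathcal S}D_j-\lambda_{L-m}^C(\mathcal S)\le C\tau_m$ for $m=0,\dots,L$. Put $H(\mathcal S)=(\lambda_m^C(\mathcal S)-\lambda_{m-1}^C(\mathcal S))_{m=1}^L$. **DP($\mathcal T$).** Start with the list $A(0)=\{(\emptyset,0)\}$. For $j=1,\dots,n$ obtain $A(j)$ from $A(j-1)$ by adding, for each $(\mathcal F,v(\mathcal F))\in A(j-1)$, the pair $(\mathcal F\cup\{T_j\},v(\mathcal F\cup\{T_j\}))$ if $\mathcal F\cup\{T_j\}$ satisfies the boundary condition, and then removing dominated pairs, i.e. keeping one pair of maximum value for each vector $H$. Return the set $\mathcal S$ of a pair of maximum value in $A(n)$. The list is stored as a table indexed by the vectors $H$; ties are broken arbitrarily. **LDF($\mathcal S$).**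 Start with $y=0$. For $\tau=\tau_L,\dots,\tau_1$ and each $T_i\in\mathcal S$ with $d_i=\tau$ (in any order), perform steps 1-3 below, where $\overline W(t)=C-\sum_j y_j(t)$ is the current number of available machines at $t$. Here Routine$(\Delta,\eta)$ at $t$ means: while $\overline W(t)<\Delta$, let $t'<t$ be the latest earlier slot with $\overline W(t')>0$; stop if there is none, or if $\eta=1$ and $\sum_{u<t'}y_i(u)\le\overline W(t)$; otherwise choose any task $T_{i'}$ with $y_{i'}(t)>y_{i'}(t')$, decrease $y_{i'}(t)$ by 1 and increase $y_{i'}(t')$ by 1. 1. For $t=d_i,\dots,1$: set $y_i(t)=\min\{k_i,\;D_i-\sum_{u>t}y_i(u),\;\overline W(t)\}$. 2. Let $\Omega=D_i-\sum_t y_i(t)$. For $t=d_i,d_i-1,\dots,1$, while $\Omega>0$: let $\Delta=\min\{k_i-y_i(t),\Omega\}$; if $\Delta>0$, run Routine$(\Delta,0)$ at $t$, then decrease $\Omega$ by $\overline W(t)$ and give these $\overline W(t)$ machines to $T_i$ at $t$. 3. For $t=d_i,d_i-1,\dots,1$, while $\sum_{u<t}y_i(u)>0$: let $\Delta=\min\{k_i-y_i(t),\sum_{u<t}y_i(u)\}$;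 if $\Delta>0$, run Routine$(\Delta,1)$ at $t$, let $\theta=\overline W(t)$, give $\theta$ more machines to $T_i$ at $t$, and take $\theta$ machines in total away from $T_i$ at its earliest slots. **Proposition.** For every set $\mathcal S$ output by DP($\mathcal T$), LDF($\mathcal S$) produces a feasible schedule of $\mathcal S$, and $\mathcal S$ with this schedule is an exact optimal solution to social welfare maximization, whatever choices the two algorithms make. The total number of elementary steps (arithmetic operations, comparisons and accesses to memory cells at unit cost) of DP($\mathcal T$) followed by LDF($\mathcal S$) is $O(\max\{n\,d^L C^L,\;n^2\})$, when the maximum deadline and the maximum parallelism bound are bounded by constants. More precisely, it is at most $\max\{K_0\,n\,d^LC^L,\;K_1n^2\}$, where $K_0$ is an absolute constant and $K_1$ depends only on upper bounds for $\max_i d_i$ and $\max_i k_i$. -/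

import Mathlib

/-! Malleable batch tasks on identical machines: the algorithms `dp` (selection of a set of tasks)
and `ldf` (latest deadline first), written as programs whose elementary steps are counted. -/

namespace Malleable

noncomputable section

/-! ### Step counting -/

/-- A result together with the number of elementary steps spent on computing it. -/
structure Timed (α : Type) where
  val : α
  steps : ℕ

/-- Sequential composition adds the steps; only `step` and `tick` create them. -/
instance : Monad Timed where
  pure a := ⟨a, 0⟩
  bind x f := ⟨(f x.val).val, x.steps + (f x.val).steps⟩

/-- One elementary step: a bounded number of arithmetic operations, comparisons and accesses to
memory cells (reading or writing one cell, prepending one element to a linked list). -/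
def step {α : Type} (a : α) : Timed α := ⟨a, 1⟩

/-- Spend `k` elementary steps. -/
def tick (k : ℕ) : Timed Unit := ⟨(), k⟩

/-! ### Tasks, schedules, social welfare -/

/-- A task: value, demand (workload), deadline and parallelism bound. -/
structure MTask where
  value : ℝ
  demand : ℕ
  deadline : ℕ
  bound : ℕ
  demand_pos : 0 < demand
  deadline_pos : 0 < deadline
  bound_pos : 0 < bound

/-- Minimal execution time `⌈D / k⌉`. -/
def MTask.len (x : MTask) : ℕ := (x.demand + x.bound - 1) / x.bound

/-- `y i t` machines are given to task `i` at time slot `t ≥ 1`.  The allocation `y` is a feasible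
schedule of the set `S` of tasks on `C` machines: parallelism bounds are respected, machines are
given only to tasks of `S` and only up to their deadlines, every task of `S` is fully allocated by
its deadline, and at most `C` machines are used in every time slot. -/
def IsFeasible {n : ℕ} (T : Fin n → MTask) (C : ℕ) (S : Finset (Fin n))
    (y : Fin n → ℕ → ℕ) : Prop :=
  (∀ i t, y i t ≤ (T i).bound) ∧
  (∀ i t, y i t ≠ 0 → i ∈ S ∧ 1 ≤ t ∧ t ≤ (T i).deadline) ∧
  (∀ i ∈ S, (T i).demand ≤ ∑ t ∈ Finset.Icc 1 (T i).deadline, y i t) ∧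
  (∀ t, ∑ i, y i t ≤ C)

/-- Social welfare of a set of completed tasks. -/
def welfare {n : ℕ} (T : Fin n → MTask) (S : Finset (Fin n)) : ℝ := ∑ i ∈ S, (T i).value

/-- `(S, y)` is an optimal solution to social welfare maximization on `C` machines. -/
def IsOptimal {n : ℕ} (T : Fin n → MTask) (C : ℕ) (S : Finset (Fin n))
    (y : Fin n → ℕ → ℕ) : Prop :=
  IsFeasible T C S y ∧
    ∀ (S' : Finset (Fin n)) (y' : Fin n → ℕ → ℕ), IsFeasible T C S' y' →
      welfare T S' ≤ welfare T S

/-- The maximum deadline `d`. -/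
def horizon {n : ℕ} (T : Fin n → MTask) : ℕ := Finset.univ.sup fun i => (T i).deadline

/-- The number `L` of distinct deadlines. -/
def numDeadlines {n : ℕ} (T : Fin n → MTask) : ℕ :=
  (Finset.univ.image fun i => (T i).deadline).card

/-! ### The distinct deadlines -/

/-- The list `[τ_L, …, τ_1]` of the distinct deadlines, in decreasing order: find the maximum
deadline `d`, mark the deadlines in an array with cells `0, …, d`, and scan the cells `1, …, d`. -/
def deadlines {n : ℕ} (T : Fin n → MTask) : Timed (List ℕ) := do
  let d ← (List.finRange n).foldlM (fun m i => step (max m (T i).deadline)) 0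
  tick (d + 1)
  let mark ← (List.finRange n).foldlM
    (fun (b : ℕ → Bool) i => step (Function.update b (T i).deadline true)) (fun _ => false)
  (List.range d).foldlM (fun l t => step (if mark (t + 1) then (t + 1) :: l else l)) []

/-- The interval of time slots `[start + 1, start + width]`. -/
structure Seg where
  start : ℕ
  width : ℕ

/-- From `[τ_L, …, τ_1]`, the list whose `m`-th entry (`m = 1, …, L`) is the interval
`[τ_{L-m} + 1, τ_{L-m+1}]`, where `τ_0 = 0`. -/
def segments : List ℕ → Timed (List Seg)
  | [] => step []
  | τ :: rest => do
    let r ← segments rest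
    step (⟨rest.headD 0, τ - rest.headD 0⟩ :: r)

/-! ### The dynamic program -/

/-- The contribution of a task to `λ_m`, where `c = τ_{L-m}`.  A task with `deadline ≤ c`
contributes `0` (truncated subtraction; `len` is positive). -/
def MTask.contribution (x : MTask) (c : ℕ) : ℕ :=
  if x.len ≤ x.deadline - c then x.demand else x.bound * (x.deadline - c)

/-- The list of the contributions of a task to `λ_1, …, λ_L`. -/
def contributions (x : MTask) : List Seg → Timed (List ℕ)
  | [] => step []
  | s :: segs => do
    let r ← contributions x segs
    step (x.contribution s.start :: r)

/-- Entrywise sum. -/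
def addLists : List ℕ → List ℕ → Timed (List ℕ)
  | a :: l, b :: l' => do
    let r ← addLists l l'
    step ((a + b) :: r)
  | _, _ => step []

/-- The vector `H = (λ_1^C - λ_0^C, …, λ_L^C - λ_{L-1}^C)`, computed from `λ_1, …, λ_L`;
`prev` is the current value of `λ_{m-1}^C`. -/
def utilization (C : ℕ) : List Seg → List ℕ → ℕ → Timed (List ℕ)
  | s :: segs, lam :: lams, prev => do
    let h ← step (min (lam - prev) (C * s.width))
    let r ← utilization C segs lams (prev + h)
    step (h :: r)
  | _, _, _ => step []

/-- Tests `D - λ_m^C ≤ C * τ_{L-m}` for `m = 1, …, L`, where `D` is the total demand; `prev` is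
the current value of `λ_{m-1}^C`. -/
def boundaryFrom (C D : ℕ) : List Seg → List ℕ → ℕ → Timed Bool
  | s :: segs, h :: H, prev => do
    let c ← step (decide (D ≤ C * s.start + (prev + h)))
    let r ← boundaryFrom C D segs H (prev + h)
    step (c && r)
  | _, _, _ => step true

/-- The boundary condition `D - λ_{L-m}^C ≤ C * τ_m` for all `m = 0, …, L`; `last` is `τ_L`. -/
def boundary (C D last : ℕ) (segs : List Seg) (H : List ℕ) : Timed Bool := do
  let c ← step (decide (D ≤ C * last))
  let r ← boundaryFrom C D segs H 0
  step (c && r)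

/-- Number of vectors `H` with `0 ≤ H_m ≤ C * (τ_{L-m+1} - τ_{L-m})` for all `m`. -/
def tableSize (C : ℕ) (segs : List Seg) : Timed ℕ :=
  segs.foldlM (fun N s => step (N * (C * s.width + 1))) 1

/-- Position of the vector `H` in a table indexed by all such vectors (mixed radix). -/
def address (C : ℕ) : List Seg → List ℕ → ℕ → Timed ℕ
  | s :: segs, h :: H, a => do
    let a ← step (a * (C * s.width + 1) + h)
    address C segs H a
  | _, _, a => step a

/-- A pair `(F, v(F))`, kept with the total demand of `F` and with `λ_1(F), …, λ_L(F)`. -/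
structure Entry (n : ℕ) where
  tasks : List (Fin n)
  value : ℝ
  demand : ℕ
  lams : List ℕ

/-- A list of pairs with pairwise different vectors `H`: the pair `(F, v(F))`, if there is one,
stands in the cell with the address of `H(F)`. -/
abbrev Table (n : ℕ) := ℕ → Option (Entry n)

/-- How ties between pairs of the same value are broken (`true`: take the new one). -/
abbrev TieRule (n : ℕ) := List (Fin n) → List (Fin n) → Bool

open Classical in
/-- Whether the pair `new` is preferred to the pair `old`. -/
def Entry.beats {n : ℕ} (tie : TieRule n) (new old : Entry n) : Bool :=
  decide (old.value < new.value ∨ (old.value = new.value ∧ tie new.tasks old.tasks = true))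

/-- Add a pair to the list and remove the one that is then dominated, if any. -/
def insertEntry {n : ℕ} (tie : TieRule n) (tbl : Table n) (a : ℕ) (e : Entry n) :
    Timed (Table n) :=
  match tbl a with
  | none => step (Function.update tbl a (some e))
  | some e' => step (if e.beats tie e' then Function.update tbl a (some e) else tbl)

/-- From `A(j-1)` to `A(j)`: starting from a copy of `A(j-1)`, for every `(F, v(F))` in `A(j-1)`
add the pair of `F ∪ {T_j}` if this set satisfies the boundary condition, and keep no dominated
pairs.  `N` is the size of the table, `last` is `τ_L`. -/
def dpRound {n : ℕ} (T : Fin n → MTask) (C : ℕ) (tie : TieRule n) (last : ℕ) (segs : List Seg)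
    (N : ℕ) (old : Table n) (j : Fin n) : Timed (Table n) := do
  let contr ← contributions (T j) segs
  tick N
  (List.range N).foldlM (fun (new : Table n) c => do
    tick 1
    match old c with
    | none => step new
    | some e => do
      let lams ← addLists e.lams contr
      let e' ← step (⟨j :: e.tasks, e.value + (T j).value, e.demand + (T j).demand, lams⟩ :
        Entry n)
      let H ← utilization C segs lams 0
      let ok ← boundary C e'.demand last segs H
      if ok = true then do
        let a ← address C segs H 0
        insertEntry tie new a e'
      else step new) old

/-- The pair of maximum value in the list. -/
def bestEntry {n : ℕ} (tie : TieRule n) (N : ℕ) (tbl : Table n) : Timed (Option (Entry n)) :=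
  (List.range N).foldlM (fun (best : Option (Entry n)) c =>
    match tbl c, best with
    | some e, some b => step (if e.beats tie b then some e else some b)
    | some e, none => step (some e)
    | none, b => step b) none

/-- The dynamic program: it starts from the list that contains only the pair `(∅, 0)`, treats the
tasks `T_1, …, T_n` in turn, and returns a set of maximum value in the final list. -/
def dp {n : ℕ} (T : Fin n → MTask) (C : ℕ) (tie : TieRule n) : Timed (List (Fin n)) := do
  let taus ← deadlines T
  let segs ← segments taus
  let N ← tableSize C segs
  tick (segs.length + N)
  let A₀ : Table n := Function.update (fun _ => none) 0 (some ⟨[], 0, 0, segs.map fun _ => 0⟩)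
  let A ← (List.finRange n).foldlM (dpRound T C tie (taus.headD 0) segs N) A₀
  let best ← bestEntry tie N A
  match best with
  | some e => step e.tasks
  | none => step []

/-! ### Latest deadline first -/

/-- The state of the allocation: `y i t` machines are given to task `i` at time slot `t`, and
`avail t` machines remain available at time slot `t`. -/
structure Alloc (n : ℕ) where
  y : Fin n → ℕ → ℕ
  avail : ℕ → ℕ

/-- Give `r` more machines to task `i` at `t`. -/
def Alloc.give {n : ℕ} (A : Alloc n) (i : Fin n) (t r : ℕ) : Alloc n where
  y := Function.update A.y i (Function.update (A.y i) t (A.y i t + r))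
  avail := Function.update A.avail t (A.avail t - r)

/-- Take `r` machines away from task `i` at `t`. -/
def Alloc.take {n : ℕ} (A : Alloc n) (i : Fin n) (t r : ℕ) : Alloc n where
  y := Function.update A.y i (Function.update (A.y i) t (A.y i t - r))
  avail := Function.update A.avail t (A.avail t + r)

/-- How the task `i'` is chosen, at two time slots `t` and `t'`, among the admissible ones. -/
abbrev PickRule (n : ℕ) :=
  Alloc n → ℕ → ℕ → (l : List (Fin n)) → l ≠ [] → {i : Fin n // i ∈ l}

/-- The sum of `f` over the time slots `1, …, t`. -/
def prefixSum (f : ℕ → ℕ) : ℕ → Timed ℕ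
  | 0 => step 0
  | t + 1 => do
    let a ← prefixSum f t
    step (a + f (t + 1))

/-- The latest of the time slots `1, …, t` at which a machine is available. -/
def latestFree (avail : ℕ → ℕ) : ℕ → Timed (Option ℕ)
  | 0 => step none
  | t + 1 => do
    tick 1
    if 0 < avail (t + 1) then step (some (t + 1)) else latestFree avail t

/-- The tasks of the list that have more machines at `t` than at `t'`. -/
def candidates {n : ℕ} (A : Alloc n) (t t' : ℕ) : List (Fin n) → Timed (List (Fin n))
  | [] => step []
  | j :: l => do
    let r ← candidates A t t' l
    step (if A.y j t' < A.y j t then j :: r else r)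

/-- `Routine(Δ, 1, η₂)` for the task `i` at time slot `t`: try to raise the number of available
machines at `t` to `Δ`, moving one machine's worth of work of another task from `t` to the closest
earlier time slot with an available machine.  Every pass of the loop that does not exit raises
`avail t` by one, so that `Δ` passes (the numerical argument) suffice. -/
def routine {n : ℕ} (pick : PickRule n) (S : List (Fin n)) (i : Fin n) (t Δ : ℕ) (η₂ : Bool) :
    ℕ → Alloc n → Timed (Alloc n)
  | 0, A => step A
  | fuel + 1, A => do
    tick 1
    if Δ ≤ A.avail t then step A
    else do
      let free ← latestFree A.avail (t - 1)
      match free with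
      | none => step A
      | some t' => do
        let p ← prefixSum (A.y i) (t' - 1)
        if η₂ = true ∧ p ≤ A.avail t then step A
        else do
          let cand ← candidates A t t' S
          if h : cand ≠ [] then do
            let j ← step (pick A t t' cand h).1
            tick 4
            routine pick S i t Δ η₂ fuel ((A.take j t 1).give j t' 1)
          else step A

/-- `Fully-Utilize(i)`, for the time slots `t, …, 1`; `rem` is the demand of the task that is not
yet allocated.  Returns what then remains of it, and the state. -/
def fullyUtilize {n : ℕ} (T : Fin n → MTask) (i : Fin n) :
    ℕ → ℕ → Alloc n → Timed (ℕ × Alloc n)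
  | 0, rem, A => step (rem, A)
  | t + 1, rem, A => do
    let r ← step (min (T i).bound (min rem (A.avail (t + 1))))
    tick 1
    fullyUtilize T i t (rem - r) (A.give i (t + 1) r)

/-- `Fully-Allocate(i)`, for the time slots `t, t - 1, …`; `Ω` is the demand of the task that is
not yet allocated. -/
def fullyAllocate {n : ℕ} (T : Fin n → MTask) (pick : PickRule n) (S : List (Fin n)) (i : Fin n) :
    ℕ → ℕ → Alloc n → Timed (Alloc n)
  | 0, _, A => step A
  | t + 1, Ω, A => do
    tick 1
    if Ω = 0 then step A
    else do
      let Δ ← step (min ((T i).bound - A.y i (t + 1)) Ω)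
      if Δ = 0 then fullyAllocate T pick S i t Ω A
      else do
        let A' ← routine pick S i (t + 1) Δ false Δ A
        let w ← step (A'.avail (t + 1))
        tick 2
        fullyAllocate T pick S i t (Ω - w) (A'.give i (t + 1) w)

/-- Take `θ` machines in total away from task `i`, at the earliest possible ones of the `m` time
slots `s, s + 1, …`. -/
def releaseEarliest {n : ℕ} (i : Fin n) : ℕ → ℕ → ℕ → Alloc n → Timed (Alloc n)
  | 0, _, _, A => step A
  | m + 1, s, θ, A => do
    let r ← step (min θ (A.y i s))
    tick 2
    releaseEarliest i m (s + 1) (θ - r) (A.take i s r)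

/-- `AllocateRLM(i, 1)`, for the time slots `t, t - 1, …`: move allocations of task `i` from its
earliest time slots to `t`. -/
def allocateRLM {n : ℕ} (T : Fin n → MTask) (pick : PickRule n) (S : List (Fin n)) (i : Fin n) :
    ℕ → Alloc n → Timed (Alloc n)
  | 0, A => step A
  | t + 1, A => do
    let p ← prefixSum (A.y i) t
    tick 1
    if p = 0 then step A
    else do
      let Δ ← step (min ((T i).bound - A.y i (t + 1)) p)
      if Δ = 0 then allocateRLM T pick S i t A
      else do
        let A' ← routine pick S i (t + 1) Δ true Δ A
        let θ ← step (A'.avail (t + 1))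
        tick 2
        let A'' ← releaseEarliest i t 1 θ (A'.give i (t + 1) θ)
        allocateRLM T pick S i t A''

/-- `Allocate-B(i)`. -/
def allocateB {n : ℕ} (T : Fin n → MTask) (pick : PickRule n) (S : List (Fin n)) (A : Alloc n)
    (i : Fin n) : Timed (Alloc n) := do
  let u ← fullyUtilize T i (T i).deadline (T i).demand A
  let A' ← fullyAllocate T pick S i (T i).deadline u.1 u.2
  allocateRLM T pick S i (T i).deadline A'

/-- The tasks of the list with deadline `τ`. -/
def withDeadline {n : ℕ} (T : Fin n → MTask) (τ : ℕ) : List (Fin n) → Timed (List (Fin n))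
  | [] => step []
  | i :: l => do
    let r ← withDeadline T τ l
    step (if (T i).deadline = τ then i :: r else r)

/-- `LDF(S)`, the set `S` being given as a list: for `τ = τ_L, …, τ_1`, apply `Allocate-B` to the
tasks of `S` with deadline `τ`, in the order of the list.  In the initial state nothing is
allocated and `C` machines are available at every time slot; this takes `n * d + d` steps. -/
def ldf {n : ℕ} (T : Fin n → MTask) (C : ℕ) (pick : PickRule n) (S : List (Fin n)) :
    Timed (Alloc n) := do
  let taus ← deadlines T
  tick (n * taus.headD 0 + taus.headD 0)
  taus.foldlM (fun (A : Alloc n) τ => do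
    let Sτ ← withDeadline T τ S
    Sτ.foldlM (fun (A : Alloc n) i => do
      tick 1
      allocateB T pick S A i) A) ⟨fun _ _ => 0, fun _ => C⟩

end

end Malleable

/-! The dynamic program selects an optimal set because of three facts about the boundary condition.
Write `λ^C_m = min (λ_m, λ^C_{m-1} + C w_m)`, where `w_m` is the width of the `m`-th segment from the
right; a task contributes `min (D, k (d - c))` to the `λ` of the segment that starts at `c`.

* It is necessary (`IsFeasible.boundaryOK`): what a feasible schedule processes after `c`, cut off at
  the demand of each task, is at most `λ^C`, and the rest has to fit into `C c`.
* It is compatible with dominance: the vector `H` of `F ∪ {T_j}` depends on `H(F)` and `T_j` only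
  (`hvec_add_congr`), and under the boundary condition the total demand is the sum of the entries
  of `H` (`BoundaryOK.dem_eq`). So a set may be replaced by one with the same `H` and a larger
  value, and by induction on the tasks the table contains, for every set `O` with a feasible
  schedule, a set with the vector `H(O)` and at least the value of `O` (`dpRound_spec`).
* It is sufficient (`ldf_feasible`): latest deadline first never fails.

For the last point, the state after each task satisfies `Good`: free machines become fewer towards
the right within each segment and up to the deadlines still to come, and whenever a slot `v` is
free, each treated task is at its parallelism bound from `v` on or has nothing before `v`. Hence
the usage after each deadline equals `λ^C`, the largest possible, so a task that finds no free
machine up to its deadline is already completely served, by the boundary condition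
(`Mid.demand_le`).

To restore `Good` after a task `i` one follows the number `U = W + y_i` of machines that the other
tasks leave at a slot. It decreases with time on the slots not yet considered, and at these slots `i`
takes as much as it can, except at its first slot; so the number `W` of free machines decreases as
well (`avail_anti`). When the routine needs a machine at `t` and `t'` is the latest free slot
before `t`, task `i` is at its bound at `t'`, so by counting some other task `j` has more machines at
`t` than at `t'`. Since `t'` is free and `j` is below its bound at `t'`, it has nothing before `t'`, so
moving a unit of `j` to `t'` keeps it late at all free slots (`Mid.move`). The stopping rule for
`η = true` ensures that the slots at which `i` then loses machines were free already
(`RoutineInv.debt`).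

For the running time, the table has `∏ (C w_m + 1) ≤ (2C)^L ∏ w_m` cells and treating a cell costs
`O(L)`; as `L! ∏ w_m ≤ d^L`, the factor `L` is absorbed and the constant is absolute
(`tableSize_mul_le`). Latest deadline first inspects, for each task, boundedly many slots with
boundedly many exchanges, each of which scans the list of tasks once; this gives `O(n^2)`. -/

namespace Malleable

noncomputable section

section

/-! ### Values and step counts of composed programs -/

@[simp] theorem Timed.val_bind {α β : Type} (x : Timed α) (f : α → Timed β) :
    (x >>= f).val = (f x.val).val := rfl

@[simp] theorem Timed.steps_bind {α β : Type} (x : Timed α) (f : α → Timed β) :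
    (x >>= f).steps = x.steps + (f x.val).steps := rfl

@[simp] theorem Timed.steps_pure {α : Type} (a : α) : (pure a : Timed α).steps = 0 := rfl

@[simp] theorem val_step {α : Type} (a : α) : (step a).val = a := rfl

@[simp] theorem steps_step {α : Type} (a : α) : (step a).steps = 1 := rfl

@[simp] theorem steps_tick (k : ℕ) : (tick k).steps = k := rfl

theorem Timed.val_foldlM {α β : Type} (f : β → α → Timed β) (l : List α) (b : β) :
    (l.foldlM f b).val = l.foldl (fun b a => (f b a).val) b := by
  induction l generalizing b with
  | nil => rfl
  | cons a l ih => rw [List.foldlM_cons, Timed.val_bind, ih, List.foldl_cons]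

theorem Timed.steps_foldlM_le {α β : Type} (f : β → α → Timed β) (B : ℕ) (l : List α)
    (h : ∀ b, ∀ a ∈ l, (f b a).steps ≤ B) (b : β) : (l.foldlM f b).steps ≤ l.length * B := by
  induction l generalizing b with
  | nil => simp
  | cons a l ih =>
    rw [List.foldlM_cons, Timed.steps_bind, List.length_cons]
    have h1 := h b a (by simp)
    have h2 := ih (fun b a ha => h b a (by simp [ha])) (f b a).val
    nlinarith

/-! ### The list of deadlines and the segments between them -/

variable {n : ℕ} (T : Fin n → MTask)

/-- `t` is the deadline of some task. -/
def IsDeadline (t : ℕ) : Prop := ∃ i, (T i).deadline = t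

theorem foldl_max_eq_sup (l : List (Fin n)) (m : ℕ) :
    l.foldl (fun m i => max m (T i).deadline) m =
      max m (l.toFinset.sup fun i => (T i).deadline) := by
  induction l generalizing m with
  | nil => simp
  | cons a l ih => simp [ih, max_assoc]

theorem foldl_mark (l : List (Fin n)) (b : ℕ → Bool) (t : ℕ) :
    l.foldl (fun (b : ℕ → Bool) i => Function.update b (T i).deadline true) b t = true ↔
      b t = true ∨ ∃ i ∈ l, (T i).deadline = t := by
  induction l generalizing b with
  | nil => simp
  | cons a l ih =>
    rw [List.foldl_cons, ih]
    by_cases h : t = (T a).deadline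
    · subst h; simp
    · have : ¬ (T a).deadline = t := fun h' => h h'.symm
      simp [Function.update_of_ne h, this]

theorem foldl_filter_range (mark : ℕ → Bool) (d : ℕ) :
    (List.range d).foldl (fun l t => if mark (t + 1) then (t + 1) :: l else l) [] =
      (((List.range d).map (· + 1)).filter mark).reverse := by
  induction d with
  | zero => rfl
  | succ d ih =>
    rw [List.range_succ, List.foldl_append, ih]
    by_cases h : mark (d + 1) <;> simp [h]

theorem deadline_le_horizon (i : Fin n) : (T i).deadline ≤ horizon T :=
  Finset.le_sup (f := fun i => (T i).deadline) (Finset.mem_univ i)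

theorem deadlines_val_eq : ∃ mark : ℕ → Bool, (∀ t, mark t = true ↔ IsDeadline T t) ∧
    (deadlines T).val = (((List.range (horizon T)).map (· + 1)).filter mark).reverse := by
  refine ⟨(List.finRange n).foldl
    (fun (b : ℕ → Bool) i => Function.update b (T i).deadline true) (fun _ => false), ?_, ?_⟩
  · intro t
    rw [foldl_mark]
    simp [IsDeadline]
  · simp only [deadlines, Timed.val_bind, Timed.val_foldlM, val_step, foldl_max_eq_sup]
    rw [foldl_filter_range]
    simp [horizon, List.toFinset_finRange]

theorem mem_deadlines {t : ℕ} : t ∈ (deadlines T).val ↔ IsDeadline T t := by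
  obtain ⟨mark, hm, h⟩ := deadlines_val_eq T
  rw [h]
  simp only [List.mem_reverse, List.mem_filter, List.mem_map, List.mem_range, hm]
  constructor
  · exact fun h => h.2
  · rintro ⟨i, rfl⟩
    refine ⟨⟨(T i).deadline - 1, ?_, ?_⟩, i, rfl⟩
    · have := deadline_le_horizon T i; have := (T i).deadline_pos; omega
    · have := (T i).deadline_pos; omega

theorem deadlines_pairwise : (deadlines T).val.Pairwise (· > ·) := by
  obtain ⟨mark, -, h⟩ := deadlines_val_eq T
  rw [h, List.pairwise_reverse]
  apply List.Pairwise.filter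
  rw [List.pairwise_map]
  exact List.pairwise_lt_range.imp (by intro a b; omega)

theorem deadlines_length : (deadlines T).val.length = numDeadlines T := by
  have hn : (deadlines T).val.Nodup := (deadlines_pairwise T).imp (fun h => (ne_of_gt h))
  rw [numDeadlines, ← List.toFinset_card_of_nodup hn]
  congr 1
  ext t
  simp [mem_deadlines, IsDeadline]

theorem deadlines_headD (hn : 0 < n) : (deadlines T).val.headD 0 = horizon T := by
  have hne : (Finset.univ : Finset (Fin n)).Nonempty := ⟨⟨0, hn⟩, Finset.mem_univ _⟩
  obtain ⟨i, -, hi⟩ := Finset.exists_mem_eq_sup Finset.univ hne fun i => (T i).deadline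
  have hmem : horizon T ∈ (deadlines T).val := (mem_deadlines T).2 ⟨i, hi.symm⟩
  have hp := deadlines_pairwise T
  have hm := fun t => mem_deadlines T (t := t)
  cases hl : (deadlines T).val with
  | nil => rw [hl] at hmem; simp at hmem
  | cons a l =>
    rw [hl] at hmem hp hm
    obtain ⟨j, hj⟩ := (hm a).1 (by simp)
    have h1 := deadline_le_horizon T j
    rcases List.mem_cons.1 hmem with h | h
    · simp [h]
    · have := (List.pairwise_cons.1 hp).1 _ h
      omega

/-- `segs` lists, from the last to the first, consecutive nonempty intervals that partition
`[1, top]`; the points of `P` in `[1, top]` occur only as right ends. -/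
def SegChain (P : ℕ → Prop) : ℕ → List Seg → Prop
  | top, [] => top = 0
  | top, s :: segs => s.start + s.width = top ∧ 0 < s.width ∧
      (∀ t, s.start < t → t < top → ¬ P t) ∧ SegChain P s.start segs

theorem segments_chain {P : ℕ → Prop} (l : List ℕ) (hp : l.Pairwise (· > ·))
    (hpos : ∀ t ∈ l, 0 < t) (hP : ∀ t, P t → t ≤ l.headD 0 → t ∈ l) :
    SegChain P (l.headD 0) (segments l).val := by
  induction l with
  | nil => simp [segments, SegChain]
  | cons a l ih =>
    have hlt : l.headD 0 < a := by
      cases l with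
      | nil => simpa using hpos a (by simp)
      | cons b l => simpa using (List.pairwise_cons.1 hp).1 b (by simp)
    have hle : ∀ t ∈ l, t ≤ l.headD 0 := by
      cases l with
      | nil => simp
      | cons b l =>
        intro t ht
        rcases List.mem_cons.1 ht with h | h
        · simp [h]
        · have := (List.pairwise_cons.1 (List.pairwise_cons.1 hp).2).1 t h
          simpa using this.le
    simp only [segments, Timed.val_bind, val_step, SegChain, List.headD_cons]
    refine ⟨by omega, by omega, ?_, ?_⟩
    · intro t h1 h2 h3
      have := hP t h3 (by simpa using h2.le)
      rcases List.mem_cons.1 this with h | h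
      · omega
      · have := hle t h; omega
    · refine ih (List.pairwise_cons.1 hp).2 (fun t ht => hpos t (by simp [ht])) ?_
      intro t h1 h2
      have := hP t h1 (by simp only [List.headD_cons]; omega)
      rcases List.mem_cons.1 this with h | h
      · omega
      · exact h

theorem segments_length (l : List ℕ) : (segments l).val.length = l.length := by
  induction l with
  | nil => rfl
  | cons a l ih => simp [segments, ih]

/-- The segments between the deadlines of the tasks. -/
def taskSegs : List Seg := (segments (deadlines T).val).val

theorem taskSegs_chain (hn : 0 < n) : SegChain (IsDeadline T) (horizon T) (taskSegs T) := by
  rw [← deadlines_headD T hn]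
  refine segments_chain _ (deadlines_pairwise T) ?_ fun t h _ => (mem_deadlines T).2 h
  intro t ht
  obtain ⟨i, rfl⟩ := (mem_deadlines T).1 ht
  exact (T i).deadline_pos

theorem taskSegs_length : (taskSegs T).length = numDeadlines T := by
  rw [taskSegs, segments_length, deadlines_length]

theorem SegChain.sum_width {P : ℕ → Prop} {top : ℕ} {segs : List Seg} (h : SegChain P top segs) :
    (segs.map Seg.width).sum = top := by
  induction segs generalizing top with
  | nil => exact h.symm
  | cons s segs ih =>
    have := ih h.2.2.2
    have := h.1
    simp only [List.map_cons, List.sum_cons]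
    omega

theorem SegChain.width_pos {P : ℕ → Prop} {top : ℕ} {segs : List Seg} (h : SegChain P top segs) :
    ∀ s ∈ segs, 0 < s.width := by
  induction segs generalizing top with
  | nil => simp
  | cons s segs ih =>
    intro s' hs'
    rcases List.mem_cons.1 hs' with rfl | h'
    · exact h.2.1
    · exact ih h.2.2.2 s' h'

end

section

/-! ### The boundary condition -/

theorem MTask.contribution_eq_min (x : MTask) (c : ℕ) :
    x.contribution c = min x.demand (x.bound * (x.deadline - c)) := by
  have h : x.len ≤ x.deadline - c ↔ x.demand ≤ x.bound * (x.deadline - c) := by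
    rw [MTask.len, ← Nat.lt_succ_iff, Nat.div_lt_iff_lt_mul x.bound_pos, Nat.succ_mul, mul_comm]
    have := x.bound_pos
    omega
  rw [MTask.contribution]
  split_ifs with h'
  · exact (min_eq_left (h.1 h')).symm
  · exact (min_eq_right (by by_contra h2; exact h' (h.2 (by omega)))).symm

theorem MTask.contribution_anti (x : MTask) : Antitone x.contribution := by
  intro a b h
  rw [contribution_eq_min, contribution_eq_min]
  exact min_le_min_left _ (Nat.mul_le_mul_left _ (by omega))

theorem MTask.contribution_le (x : MTask) (c : ℕ) : x.contribution c ≤ x.demand := by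
  rw [contribution_eq_min]; exact min_le_left _ _

theorem MTask.contribution_eq_zero (x : MTask) {c : ℕ} (h : x.deadline ≤ c) :
    x.contribution c = 0 := by
  rw [contribution_eq_min, Nat.sub_eq_zero_of_le h]; simp

/-- The vector `H` computed from the function `f` whose value at `τ_{L-m}` is `λ_m`; `prev` is the
value of `λ^C` before the first segment of the list. -/
def hvec (C : ℕ) (f : ℕ → ℕ) (segs : List Seg) (prev : ℕ) : List ℕ :=
  (utilization C segs (segs.map fun s => f s.start) prev).val

@[simp] theorem hvec_nil (C : ℕ) (f : ℕ → ℕ) (prev : ℕ) : hvec C f [] prev = [] := rfl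

@[simp] theorem hvec_cons (C : ℕ) (f : ℕ → ℕ) (s : Seg) (segs : List Seg) (prev : ℕ) :
    hvec C f (s :: segs) prev = min (f s.start - prev) (C * s.width) ::
      hvec C f segs (prev + min (f s.start - prev) (C * s.width)) := rfl

theorem boundaryFrom_cons (C D : ℕ) (s : Seg) (segs : List Seg) (h : ℕ) (H : List ℕ) (prev : ℕ) :
    (boundaryFrom C D (s :: segs) (h :: H) prev).val = true ↔
      D ≤ C * s.start + (prev + h) ∧ (boundaryFrom C D segs H (prev + h)).val = true := by
  simp [boundaryFrom]

theorem boundary_val_iff (C D last : ℕ) (segs : List Seg) (H : List ℕ) :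
    (boundary C D last segs H).val = true ↔
      D ≤ C * last ∧ (boundaryFrom C D segs H 0).val = true := by
  simp [boundary]

/-- If `G c` bounds the work that can be done after `c`, then `λ^C` is at least `G`. -/
theorem boundaryFrom_of_le {P : ℕ → Prop} {C D : ℕ} {f G : ℕ → ℕ} (hf : ∀ c, G c ≤ f c)
    (hG : ∀ c w, G c ≤ G (c + w) + C * w) (hD : ∀ c, D ≤ C * c + G c) {top : ℕ}
    {segs : List Seg} (hc : SegChain P top segs) {prev : ℕ} (hp : G top ≤ prev) :
    (boundaryFrom C D segs (hvec C f segs prev) prev).val = true := by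
  induction segs generalizing top prev with
  | nil => rfl
  | cons s segs ih =>
    rw [hvec_cons, boundaryFrom_cons]
    have h1 := hc.1
    have h2 := hG s.start s.width
    rw [h1] at h2
    have h3 := hf s.start
    have h4 : G s.start ≤ prev + min (f s.start - prev) (C * s.width) := by omega
    exact ⟨(hD s.start).trans (by omega), ih hc.2.2.2 h4⟩

/-- The vector `H` of a sum is determined by the vector `H` of one summand. -/
theorem hvec_add_congr {C : ℕ} {f g a : ℕ → ℕ} (hf : Antitone f) (hg : Antitone g)
    (ha : Antitone a) {P : ℕ → Prop} {top : ℕ} {segs : List Seg} (hc : SegChain P top segs)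
    {x x' : ℕ} (hxf : x ≤ f top) (hxg : x ≤ g top) (hx : x' ≤ x + a top)
    (h : hvec C f segs x = hvec C g segs x) :
    hvec C (fun c => f c + a c) segs x' = hvec C (fun c => g c + a c) segs x' := by
  induction segs generalizing top x x' with
  | nil => rfl
  | cons s segs ih =>
    have h1 := hc.1
    have f1 := hf (show s.start ≤ top by omega)
    have g1 := hg (show s.start ≤ top by omega)
    have a1 := ha (show s.start ≤ top by omega)
    simp only [hvec_cons, List.cons.injEq] at h ⊢
    obtain ⟨e1, e2⟩ := h
    have e3 : min (f s.start + a s.start - x') (C * s.width) =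
        min (g s.start + a s.start - x') (C * s.width) := by omega
    rw [← e1] at e2
    rw [← e3]
    exact ⟨rfl, ih hc.2.2.2 (by omega) (by omega) (by omega) e2⟩

theorem sum_hvec_le {C : ℕ} {f : ℕ → ℕ} {B : ℕ} (hf : ∀ c, f c ≤ B) (segs : List Seg)
    {prev : ℕ} (hp : prev ≤ B) : prev + (hvec C f segs prev).sum ≤ B := by
  induction segs generalizing prev with
  | nil => simpa using hp
  | cons s segs ih =>
    simp only [hvec_cons, List.sum_cons]
    have := hf s.start
    have := ih (prev := prev + min (f s.start - prev) (C * s.width)) (by omega)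
    omega

theorem le_sum_of_boundaryFrom {P : ℕ → Prop} {C D : ℕ} {f : ℕ → ℕ} {top : ℕ} {segs : List Seg}
    (hc : SegChain P top segs) {prev : ℕ} (hD : D ≤ C * top + prev)
    (hb : (boundaryFrom C D segs (hvec C f segs prev) prev).val = true) :
    D ≤ prev + (hvec C f segs prev).sum := by
  induction segs generalizing top prev with
  | nil =>
    have : top = 0 := hc
    simpa [this] using hD
  | cons s segs ih =>
    rw [hvec_cons, boundaryFrom_cons] at hb
    have := ih hc.2.2.2 hb.1 hb.2
    simp only [hvec_cons, List.sum_cons]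
    omega

/-- If the usage `G` of a schedule is, on each segment that starts at `c` or later, as large as
`λ^C` permits, then the boundary condition bounds the demand in terms of `G c`. -/
theorem demand_le_of_boundaryFrom {P : ℕ → Prop} {C D c : ℕ} {f G : ℕ → ℕ} {top : ℕ}
    {segs : List Seg} (hc : SegChain P top segs) (hP : P c) (hlt : c < top) (hpos : 0 < c)
    {prev : ℕ} (hp : prev ≤ G top)
    (hG : ∀ s w, c ≤ s → (∀ t, s < t → t < s + w → ¬ P t) → s + w ≤ top →
      min (f s) (G (s + w) + C * w) ≤ G s)
    (hmono : Antitone G)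
    (hb : (boundaryFrom C D segs (hvec C f segs prev) prev).val = true) :
    D ≤ C * c + G c := by
  induction segs generalizing top prev with
  | nil =>
    have : top = 0 := hc
    omega
  | cons s segs ih =>
    rw [hvec_cons, boundaryFrom_cons] at hb
    obtain ⟨h1, h2, h3, h4⟩ := hc
    have hcs : c ≤ s.start := by
      by_contra h
      exact h3 c (by omega) hlt hP
    have h5 := hG s.start s.width hcs (by rw [h1]; exact h3) h1.le
    have h7 := hmono (show s.start ≤ top by omega)
    have h6 : prev + min (f s.start - prev) (C * s.width) ≤ G s.start := by
      rw [h1] at h5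
      omega
    rcases hcs.eq_or_lt with h | h
    · subst h
      exact hb.1.trans (by omega)
    · exact ih h4 h h6 (fun s' w ha hb hc => hG s' w ha hb (by omega)) hb.2

/-! ### Sets of tasks -/

variable {n : ℕ} (T : Fin n → MTask)

/-- `λ_m(O)` as a function of `c = τ_{L-m}`. -/
def lam (O : Finset (Fin n)) (c : ℕ) : ℕ := ∑ j ∈ O, (T j).contribution c

/-- The total demand of a set of tasks. -/
def dem (O : Finset (Fin n)) : ℕ := ∑ j ∈ O, (T j).demand

/-- The vector `H(O)`. -/
def hv (C : ℕ) (O : Finset (Fin n)) : List ℕ := hvec C (lam T O) (taskSegs T) 0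

/-- The set `O` satisfies the boundary condition. -/
def BoundaryOK (C : ℕ) (O : Finset (Fin n)) : Prop :=
  (boundary C (dem T O) (horizon T) (taskSegs T) (hv T C O)).val = true

theorem lam_anti (O : Finset (Fin n)) : Antitone (lam T O) := fun _ _ h =>
  Finset.sum_le_sum fun j _ => (T j).contribution_anti h

theorem lam_le (O : Finset (Fin n)) (c : ℕ) : lam T O c ≤ dem T O :=
  Finset.sum_le_sum fun j _ => (T j).contribution_le c

theorem lam_insert {O : Finset (Fin n)} {j : Fin n} (h : j ∉ O) :
    lam T (insert j O) = fun c => lam T O c + (T j).contribution c := by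
  funext c
  rw [lam, Finset.sum_insert h, add_comm]; rfl

theorem dem_insert {O : Finset (Fin n)} {j : Fin n} (h : j ∉ O) :
    dem T (insert j O) = dem T O + (T j).demand := by
  rw [dem, Finset.sum_insert h, add_comm]; rfl

variable {T}

/-- A set that satisfies the boundary condition has its total demand encoded in its vector `H`. -/
theorem BoundaryOK.dem_eq (hn : 0 < n) {C : ℕ} {O : Finset (Fin n)} (h : BoundaryOK T C O) :
    dem T O = (hv T C O).sum := by
  have h' := (boundary_val_iff _ _ _ _ _).1 h
  have h1 := le_sum_of_boundaryFrom (taskSegs_chain T hn) (prev := 0) (by simpa using h'.1) h'.2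
  have h2 := sum_hvec_le (C := C) (lam_le T O) (taskSegs T) (Nat.zero_le _)
  rw [hv]
  omega

theorem hv_insert_congr (hn : 0 < n) {C : ℕ} {O O' : Finset (Fin n)} {j : Fin n} (hj : j ∉ O)
    (hj' : j ∉ O') (h : hv T C O = hv T C O') : hv T C (insert j O) = hv T C (insert j O') := by
  rw [hv, hv, lam_insert T hj, lam_insert T hj']
  exact hvec_add_congr (lam_anti T O) (lam_anti T O') (T j).contribution_anti
    (taskSegs_chain T hn) (Nat.zero_le _) (Nat.zero_le _) (Nat.zero_le _) h

theorem BoundaryOK.congr {C : ℕ} {O O' : Finset (Fin n)} (h : BoundaryOK T C O)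
    (hd : dem T O = dem T O') (hH : hv T C O = hv T C O') : BoundaryOK T C O' := by
  rw [BoundaryOK, ← hd, ← hH]; exact h

/-- Every set of tasks that are completed by some feasible schedule satisfies the boundary
condition. -/
theorem IsFeasible.boundaryOK (hn : 0 < n) {C : ℕ} {S O : Finset (Fin n)} {y : Fin n → ℕ → ℕ}
    (h : IsFeasible T C S y) (hO : O ⊆ S) : BoundaryOK T C O := by
  obtain ⟨h1, h2, h3, h4⟩ := h
  -- The allocation after `c`, with what exceeds the demand of a task left out.
  let G : ℕ → ℕ := fun c =>
    ∑ j ∈ O, min (T j).demand (∑ t ∈ Finset.Ioc c (T j).deadline, y j t)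
  have hcol : ∀ a b, (∑ j ∈ O, ∑ t ∈ Finset.Ioc a b, y j t) ≤ C * (b - a) := by
    intro a b
    rw [Finset.sum_comm]
    calc _ ≤ ∑ t ∈ Finset.Ioc a b, C := Finset.sum_le_sum fun t _ =>
            (Finset.sum_le_sum_of_subset (Finset.subset_univ O)).trans (h4 t)
      _ = C * (b - a) := by simp [mul_comm]
  have hsplit : ∀ j a b, (∑ t ∈ Finset.Ioc a (T j).deadline, y j t) ≤
      (∑ t ∈ Finset.Ioc a b, y j t) + ∑ t ∈ Finset.Ioc b (T j).deadline, y j t := by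
    intro j a b
    rw [← Finset.sum_union_inter]
    refine (Finset.sum_le_sum_of_subset ?_).trans (Nat.le_add_right _ _)
    intro t
    simp only [Finset.mem_union, Finset.mem_Ioc]
    omega
  have hGf : ∀ c, G c ≤ lam T O c := fun c => by
    refine Finset.sum_le_sum fun j _ => ?_
    rw [MTask.contribution_eq_min]
    refine min_le_min_left _ ?_
    calc _ ≤ ∑ t ∈ Finset.Ioc c (T j).deadline, (T j).bound := Finset.sum_le_sum fun t _ => h1 j t
      _ = _ := by simp [mul_comm]
  have hGG : ∀ c w, G c ≤ G (c + w) + C * w := fun c w => by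
    have := hcol c (c + w)
    rw [Nat.add_sub_cancel_left] at this
    refine le_trans ?_ (Nat.add_le_add_left this _)
    rw [← Finset.sum_add_distrib]
    refine Finset.sum_le_sum fun j _ => ?_
    have := hsplit j c (c + w)
    omega
  have hD : ∀ c, dem T O ≤ C * c + G c := fun c => by
    have := hcol 0 c
    refine le_trans ?_ (Nat.add_le_add_right this _)
    rw [← Finset.sum_add_distrib]
    refine Finset.sum_le_sum fun j hj => ?_
    have := hsplit j 0 c
    have h5 := h3 j (hO hj)
    have : Finset.Icc 1 (T j).deadline = Finset.Ioc 0 (T j).deadline := by ext; simp; omega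
    rw [this] at h5
    omega
  have hG0 : G (horizon T) = 0 := by
    refine Finset.sum_eq_zero fun j _ => ?_
    rw [Finset.Ioc_eq_empty (by simpa using deadline_le_horizon T j)]
    simp
  refine (boundary_val_iff _ _ _ _ _).2 ⟨by simpa [hG0] using hD (horizon T), ?_⟩
  exact boundaryFrom_of_le hGf hGG hD (taskSegs_chain T hn) hG0.le

end

section

/-! ### The table of the dynamic program -/

theorem contributions_val (x : MTask) (segs : List Seg) :
    (contributions x segs).val = segs.map fun s => x.contribution s.start := by
  induction segs with
  | nil => rfl
  | cons s segs ih => simp [contributions, ih]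

theorem addLists_val (f g : Seg → ℕ) (segs : List Seg) :
    (addLists (segs.map f) (segs.map g)).val = segs.map fun s => f s + g s := by
  induction segs with
  | nil => rfl
  | cons s segs ih => simp [addLists, ih]

theorem tableSize_val (C : ℕ) (segs : List Seg) :
    (tableSize C segs).val = (segs.map fun s => C * s.width + 1).prod := by
  have : ∀ N, segs.foldl (fun N s => N * (C * s.width + 1)) N =
      N * (segs.map fun s => C * s.width + 1).prod := by
    induction segs with
    | nil => simp
    | cons s segs ih => intro N; simp [ih, mul_assoc]
  simpa [tableSize, Timed.val_foldlM] using this 1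

theorem address_lt (C : ℕ) (f : ℕ → ℕ) (segs : List Seg) (prev a : ℕ) :
    (address C segs (hvec C f segs prev) a).val <
      (a + 1) * (segs.map fun s => C * s.width + 1).prod := by
  induction segs generalizing prev a with
  | nil => simp [address]
  | cons s segs ih =>
    simp only [hvec_cons, address, Timed.val_bind, val_step, List.map_cons, List.prod_cons]
    refine (ih _ _).trans_le ?_
    rw [← mul_assoc]
    refine Nat.mul_le_mul_right _ ?_
    have := min_le_right (f s.start - prev) (C * s.width)
    rw [add_mul]
    omega

theorem address_inj {C : ℕ} {f g : ℕ → ℕ} {segs : List Seg} {p q a b : ℕ}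
    (h : (address C segs (hvec C f segs p) a).val = (address C segs (hvec C g segs q) b).val) :
    a = b ∧ hvec C f segs p = hvec C g segs q := by
  induction segs generalizing p q a b with
  | nil => exact ⟨h, rfl⟩
  | cons s segs ih =>
    simp only [hvec_cons, address, Timed.val_bind, val_step] at h ⊢
    obtain ⟨h1, h2⟩ := ih h
    generalize hx : min (f s.start - p) (C * s.width) = x at h1 h2 ⊢
    generalize hy : min (g s.start - q) (C * s.width) = z at h1 h2 ⊢
    have hx' : x < C * s.width + 1 := by omega
    have hy' : z < C * s.width + 1 := by omega
    have e1 := congrArg (· / (C * s.width + 1)) h1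
    have e2 := congrArg (· % (C * s.width + 1)) h1
    simp only [mul_comm _ (C * s.width + 1), Nat.mul_add_div (Nat.succ_pos _),
      Nat.div_eq_of_lt hx', Nat.div_eq_of_lt hy', Nat.mul_add_mod, Nat.mod_eq_of_lt hx',
      Nat.mod_eq_of_lt hy', add_zero] at e1 e2
    subst e2
    exact ⟨e1, by rw [h2]⟩

theorem address_zero (C : ℕ) (segs : List Seg) :
    (address C segs (hvec C (fun _ => 0) segs 0) 0).val = 0 := by
  induction segs with
  | nil => rfl
  | cons s segs ih => simpa [address] using ih

variable {n : ℕ} (T : Fin n → MTask)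

/-- The cell of the table that belongs to the vector `H(O)`. -/
def cell (C : ℕ) (O : Finset (Fin n)) : ℕ := (address C (taskSegs T) (hv T C O) 0).val

theorem cell_lt (C : ℕ) (O : Finset (Fin n)) :
    cell T C O < (tableSize C (taskSegs T)).val := by
  rw [tableSize_val]
  exact (address_lt C (lam T O) (taskSegs T) 0 0).trans_le (by simp)

variable {T} in
theorem hv_eq_of_cell_eq {C : ℕ} {O O' : Finset (Fin n)} (h : cell T C O = cell T C O') :
    hv T C O = hv T C O' := (address_inj h).2

theorem cell_empty (C : ℕ) : cell T C ∅ = 0 := address_zero C (taskSegs T)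

/-- The pair obtained from a pair by adding the task `j`. -/
def Entry.extend (e : Entry n) (j : Fin n) : Entry n :=
  ⟨j :: e.tasks, e.value + (T j).value, e.demand + (T j).demand,
    (addLists e.lams (contributions (T j) (taskSegs T)).val).val⟩

/-- The fields of the entry describe its set of tasks, which is a subset of `P` that satisfies the
boundary condition. -/
structure Entry.Valid (C : ℕ) (P : Finset (Fin n)) (e : Entry n) : Prop where
  nodup : e.tasks.Nodup
  subset : e.tasks.toFinset ⊆ P
  value_eq : e.value = welfare T e.tasks.toFinset
  demand_eq : e.demand = dem T e.tasks.toFinset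
  lams_eq : e.lams = (taskSegs T).map fun s => lam T e.tasks.toFinset s.start
  boundary : BoundaryOK T C e.tasks.toFinset

/-- Every entry of the table is valid and stands in its cell. -/
def TableValid (C : ℕ) (P : Finset (Fin n)) (tbl : Table n) : Prop :=
  ∀ a e, tbl a = some e → e.Valid T C P ∧ a = cell T C e.tasks.toFinset

/-- In every cell, the value in the second table is at least the value in the first one. -/
def Table.Below (tbl tbl' : Table n) : Prop :=
  ∀ a e, tbl a = some e → ∃ e', tbl' a = some e' ∧ e.value ≤ e'.value

theorem Table.Below.trans {t₁ t₂ t₃ : Table n} (h : t₁.Below t₂) (h' : t₂.Below t₃) :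
    t₁.Below t₃ := by
  intro a e he
  obtain ⟨e', h1, h2⟩ := h a e he
  obtain ⟨e'', h3, h4⟩ := h' a e' h1
  exact ⟨e'', h3, h2.trans h4⟩

theorem Table.Below.refl (t : Table n) : t.Below t := fun _ e h => ⟨e, h, le_rfl⟩

theorem Entry.beats_le {tie : TieRule n} {new old : Entry n} (h : new.beats tie old = true) :
    old.value ≤ new.value := by
  rcases of_decide_eq_true h with h | h
  · exact h.le
  · exact h.1.le

theorem Entry.le_of_not_beats {tie : TieRule n} {new old : Entry n}
    (h : ¬ new.beats tie old = true) : new.value ≤ old.value := by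
  by_contra h'
  exact h (decide_eq_true (Or.inl (not_le.1 h')))

theorem insertEntry_spec (tie : TieRule n) (tbl : Table n) (a : ℕ) (e : Entry n) :
    tbl.Below (insertEntry tie tbl a e).val ∧
    (∃ e', (insertEntry tie tbl a e).val a = some e' ∧ e.value ≤ e'.value) ∧
    ∀ b e', (insertEntry tie tbl a e).val b = some e' → tbl b = some e' ∨ (b = a ∧ e' = e) := by
  have key : ∀ b e', Function.update tbl a (some e) b = some e' →
      tbl b = some e' ∨ (b = a ∧ e' = e) := by
    intro b e' h
    by_cases hb : b = a
    · subst hb; simp at h; exact Or.inr ⟨rfl, h.symm⟩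
    · rw [Function.update_of_ne hb] at h; exact Or.inl h
  unfold insertEntry
  cases h : tbl a with
  | none =>
    refine ⟨?_, ⟨e, by simp, le_rfl⟩, key⟩
    intro b e' hb
    refine ⟨e', ?_, le_rfl⟩
    have : b ≠ a := by rintro rfl; simp [h] at hb
    simpa [Function.update_of_ne this] using hb
  | some e₀ =>
    simp only [val_step]
    split_ifs with hb
    · refine ⟨?_, ⟨e, by simp, le_rfl⟩, key⟩
      intro b e' hb'
      by_cases hba : b = a
      · subst hba
        rw [h] at hb'
        exact ⟨e, by simp, by simpa [Option.some.inj hb'] using Entry.beats_le hb⟩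
      · exact ⟨e', by simpa [Function.update_of_ne hba] using hb', le_rfl⟩
    · exact ⟨Table.Below.refl _, ⟨e₀, h, Entry.le_of_not_beats hb⟩, fun b e' h => Or.inl h⟩

/-- The effect of one cell of `A(j-1)` on the new table. -/
def dpCell (C : ℕ) (tie : TieRule n) (j : Fin n) (old new : Table n) (c : ℕ) : Table n :=
  match old c with
  | none => new
  | some e =>
    if (boundary C (e.extend T j).demand (horizon T) (taskSegs T)
        (utilization C (taskSegs T) (e.extend T j).lams 0).val).val = true then
      (insertEntry tie new (address C (taskSegs T)
        (utilization C (taskSegs T) (e.extend T j).lams 0).val 0).val (e.extend T j)).val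
    else new

theorem dpRound_val (C : ℕ) (tie : TieRule n) (N : ℕ) (old : Table n) (j : Fin n) :
    (dpRound T C tie (horizon T) (taskSegs T) N old j).val =
      (List.range N).foldl (dpCell T C tie j old) old := by
  simp only [dpRound, Timed.val_bind, Timed.val_foldlM]
  congr 1
  funext new c
  unfold dpCell
  cases old c with
  | none => rfl
  | some e =>
    simp only [Timed.val_bind, val_step]
    exact apply_ite Timed.val _ _ _

variable {T}

theorem Entry.Valid.mono {C : ℕ} {P Q : Finset (Fin n)} {e : Entry n} (h : e.Valid T C P)
    (hPQ : P ⊆ Q) : e.Valid T C Q :=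
  ⟨h.nodup, h.subset.trans hPQ, h.value_eq, h.demand_eq, h.lams_eq, h.boundary⟩

theorem welfare_insert {O : Finset (Fin n)} {j : Fin n} (h : j ∉ O) :
    welfare T (insert j O) = welfare T O + (T j).value := by
  rw [welfare, Finset.sum_insert h, add_comm]; rfl

theorem Entry.Valid.lams_extend {C : ℕ} {P : Finset (Fin n)} {e : Entry n} (h : e.Valid T C P)
    {j : Fin n} (hj : j ∉ P) : (e.extend T j).lams =
      (taskSegs T).map fun s => lam T (insert j e.tasks.toFinset) s.start := by
  have hj' : j ∉ e.tasks.toFinset := fun h' => hj (h.subset h')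
  simp only [Entry.extend, contributions_val, h.lams_eq, addLists_val, lam_insert T hj']

theorem Entry.Valid.extend {C : ℕ} {P : Finset (Fin n)} {e : Entry n} (h : e.Valid T C P)
    {j : Fin n} (hj : j ∉ P) (hb : BoundaryOK T C (insert j e.tasks.toFinset)) :
    (e.extend T j).Valid T C (insert j P) := by
  have hj' : j ∉ e.tasks.toFinset := fun h' => hj (h.subset h')
  have ht : (e.extend T j).tasks.toFinset = insert j e.tasks.toFinset := by
    simp [Entry.extend]
  refine ⟨?_, ?_, ?_, ?_, ?_, ?_⟩
  · exact List.nodup_cons.2 ⟨by simpa using hj', h.nodup⟩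
  · rw [ht]; exact Finset.insert_subset_insert _ h.subset
  · rw [ht, welfare_insert hj', ← h.value_eq]; rfl
  · rw [ht, dem_insert T hj', ← h.demand_eq]; rfl
  · rw [ht, h.lams_extend hj]
  · rw [ht]; exact hb

theorem dpCell_spec {C : ℕ} {tie : TieRule n} {P : Finset (Fin n)} {j : Fin n} (hj : j ∉ P)
    {old new : Table n} (hold : TableValid T C P old) (hnew : TableValid T C (insert j P) new)
    (c : ℕ) :
    TableValid T C (insert j P) (dpCell T C tie j old new c) ∧
    new.Below (dpCell T C tie j old new c) ∧
    ∀ e, old c = some e → BoundaryOK T C (insert j e.tasks.toFinset) →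
      ∃ e', dpCell T C tie j old new c (cell T C (insert j e.tasks.toFinset)) = some e' ∧
        e.value + (T j).value ≤ e'.value := by
  unfold dpCell
  cases h : old c with
  | none => exact ⟨hnew, Table.Below.refl _, by simp⟩
  | some e =>
    obtain ⟨he, -⟩ := hold c e h
    have hj' : j ∉ e.tasks.toFinset := fun h' => hj (he.subset h')
    have hH : (utilization C (taskSegs T) (e.extend T j).lams 0).val =
        hv T C (insert j e.tasks.toFinset) := by
      rw [he.lams_extend hj]; rfl
    have hd : (e.extend T j).demand = dem T (insert j e.tasks.toFinset) := by
      rw [dem_insert T hj', ← he.demand_eq]; rfl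
    have ht : (e.extend T j).tasks.toFinset = insert j e.tasks.toFinset := by
      simp [Entry.extend]
    simp only [hH, hd]
    split_ifs with hb
    · obtain ⟨s1, s2, s3⟩ := insertEntry_spec tie new (cell T C (insert j e.tasks.toFinset))
        (e.extend T j)
      refine ⟨?_, s1, ?_⟩
      · intro a e' ha
        rcases s3 a e' ha with h1 | ⟨rfl, rfl⟩
        · exact hnew a e' h1
        · exact ⟨he.extend hj hb, by rw [ht]⟩
      · intro e₁ he₁ _
        obtain rfl := Option.some.inj he₁
        exact s2
    · refine ⟨hnew, Table.Below.refl _, ?_⟩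
      intro e₁ he₁ hb'
      obtain rfl := Option.some.inj he₁
      exact absurd hb' hb

theorem dpCell_foldl_spec {C : ℕ} {tie : TieRule n} {P : Finset (Fin n)} {j : Fin n} (hj : j ∉ P)
    {old : Table n} (hold : TableValid T C P old) (l : List ℕ) {new : Table n}
    (hnew : TableValid T C (insert j P) new) :
    TableValid T C (insert j P) (l.foldl (dpCell T C tie j old) new) ∧
    new.Below (l.foldl (dpCell T C tie j old) new) ∧
    ∀ c ∈ l, ∀ e, old c = some e → BoundaryOK T C (insert j e.tasks.toFinset) →
      ∃ e', l.foldl (dpCell T C tie j old) new (cell T C (insert j e.tasks.toFinset)) = some e' ∧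
        e.value + (T j).value ≤ e'.value := by
  induction l generalizing new with
  | nil => exact ⟨hnew, Table.Below.refl _, by simp⟩
  | cons c l ih =>
    obtain ⟨a1, a2, a3⟩ := dpCell_spec (tie := tie) hj hold hnew c
    obtain ⟨b1, b2, b3⟩ := ih a1
    refine ⟨b1, a2.trans b2, ?_⟩
    intro c' hc' e he hb
    rcases List.mem_cons.1 hc' with rfl | hc'
    · obtain ⟨e', h1, h2⟩ := a3 e he hb
      obtain ⟨e'', h3, h4⟩ := b2 _ _ h1
      exact ⟨e'', h3, h2.trans h4⟩
    · exact b3 c' hc' e he hb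

/-- For every subset of `P` all of whose tasks belong to `S`, the table holds a pair with the same
vector `H` and at least the same value. -/
def TableComplete (T : Fin n → MTask) (C : ℕ) (S P : Finset (Fin n)) (tbl : Table n) : Prop :=
  ∀ O ⊆ P, O ⊆ S → ∃ e, tbl (cell T C O) = some e ∧ welfare T O ≤ e.value

/-- Removing dominated pairs keeps the table complete: two sets with the same vector `H` have the
same demand, and they still have the same vector `H` after the task `j` is added. -/
theorem dpRound_spec (hn : 0 < n) {C : ℕ} {tie : TieRule n} {S P : Finset (Fin n)} {j : Fin n}
    (hj : j ∉ P) (hS : ∀ O ⊆ S, BoundaryOK T C O) {old : Table n} (hold : TableValid T C P old)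
    (hc : TableComplete T C S P old) :
    let new := (dpRound T C tie (horizon T) (taskSegs T)
      (tableSize C (taskSegs T)).val old j).val
    TableValid T C (insert j P) new ∧ TableComplete T C S (insert j P) new := by
  intro new
  have hnew : TableValid T C (insert j P) old := fun a e h =>
    ⟨(hold a e h).1.mono (Finset.subset_insert _ _), (hold a e h).2⟩
  obtain ⟨h1, h2, h3⟩ := dpCell_foldl_spec (tie := tie) hj hold
    (List.range (tableSize C (taskSegs T)).val) hnew
  rw [← dpRound_val] at h1 h2 h3
  refine ⟨h1, ?_⟩
  intro O hOP hOS
  by_cases hjO : j ∈ O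
  · obtain ⟨O, hjO', rfl⟩ : ∃ O', j ∉ O' ∧ O = insert j O' :=
      ⟨O.erase j, Finset.notMem_erase _ _, (Finset.insert_erase hjO).symm⟩
    have hOP' : O ⊆ P := fun i hi => by
      rcases Finset.mem_insert.1 (hOP (Finset.mem_insert_of_mem hi)) with rfl | h
      · exact absurd hi hjO'
      · exact h
    have hOS' : O ⊆ S := (Finset.subset_insert _ _).trans hOS
    obtain ⟨e, he, hw⟩ := hc O hOP' hOS'
    obtain ⟨hv1, hcell⟩ := hold _ e he
    have hje : j ∉ e.tasks.toFinset := fun h' => hj (hv1.subset h')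
    have hH := hv_eq_of_cell_eq hcell
    have hdem : dem T O = dem T e.tasks.toFinset := by
      rw [(hS O hOS').dem_eq hn, hv1.boundary.dem_eq hn, hH]
    have hH' := hv_insert_congr hn hjO' hje hH
    have hb : BoundaryOK T C (insert j e.tasks.toFinset) :=
      (hS _ hOS).congr (by rw [dem_insert T hjO', dem_insert T hje, hdem]) hH'
    obtain ⟨e', he', hw'⟩ := h3 _ (List.mem_range.2 (cell_lt T C O)) e he hb
    refine ⟨e', ?_, ?_⟩
    · have : cell T C (insert j O) = cell T C (insert j e.tasks.toFinset) := by
        rw [cell, hH']; rfl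
      rw [this]; exact he'
    · rw [welfare_insert hjO']; linarith
  · obtain ⟨e, he, hw⟩ := hc O ((Finset.subset_insert_iff_of_notMem hjO).1 hOP) hOS
    obtain ⟨e', he', hw'⟩ := h2 _ e he
    exact ⟨e', he', hw.trans hw'⟩

theorem dpRound_foldl_spec (hn : 0 < n) {C : ℕ} {tie : TieRule n} {S P : Finset (Fin n)}
    (hS : ∀ O ⊆ S, BoundaryOK T C O) {l : List (Fin n)} (hl : l.Nodup) (hlP : ∀ i ∈ l, i ∉ P)
    {tbl : Table n} (hv : TableValid T C P tbl) (hc : TableComplete T C S P tbl) :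
    let new := l.foldl (fun tbl j => (dpRound T C tie (horizon T) (taskSegs T)
      (tableSize C (taskSegs T)).val tbl j).val) tbl
    TableValid T C (l.toFinset ∪ P) new ∧ TableComplete T C S (l.toFinset ∪ P) new := by
  induction l generalizing tbl P with
  | nil => simpa using ⟨hv, hc⟩
  | cons j l ih =>
    obtain ⟨h1, h2⟩ := dpRound_spec (tie := tie) hn (hlP j (by simp)) hS hv hc
    have := ih (List.nodup_cons.1 hl).2 (fun i hi => ?_) h1 h2
    · simpa [Finset.insert_union, Finset.union_insert] using this
    · rw [Finset.mem_insert, not_or]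
      refine ⟨?_, hlP i (by simp [hi])⟩
      rintro rfl
      exact (List.nodup_cons.1 hl).1 hi

/-- One comparison in the search for the best entry. -/
def betterEntry (tie : TieRule n) (tbl : Table n) (best : Option (Entry n)) (c : ℕ) :
    Option (Entry n) :=
  match tbl c, best with
  | some e, some b => if e.beats tie b then some e else some b
  | some e, none => some e
  | none, b => b

theorem bestEntry_val (tie : TieRule n) (N : ℕ) (tbl : Table n) :
    (bestEntry tie N tbl).val = (List.range N).foldl (betterEntry tie tbl) none := by
  rw [bestEntry, Timed.val_foldlM]
  congr 1
  funext b c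
  unfold betterEntry
  cases tbl c <;> cases b <;> rfl

theorem betterEntry_foldl_spec (tie : TieRule n) (tbl : Table n) (l : List ℕ)
    (best : Option (Entry n)) :
    (∀ e, l.foldl (betterEntry tie tbl) best = some e → best = some e ∨ ∃ a, tbl a = some e) ∧
    (∀ e, best = some e → ∃ e', l.foldl (betterEntry tie tbl) best = some e' ∧
      e.value ≤ e'.value) ∧
    ∀ a ∈ l, ∀ e, tbl a = some e → ∃ e', l.foldl (betterEntry tie tbl) best = some e' ∧
      e.value ≤ e'.value := by
  induction l generalizing best with
  | nil => exact ⟨fun e h => Or.inl h, fun e h => ⟨e, h, le_rfl⟩, by simp⟩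
  | cons c l ih =>
    obtain ⟨h1, h2, h3⟩ := ih (betterEntry tie tbl best c)
    have hs : (∀ e, betterEntry tie tbl best c = some e → best = some e ∨ ∃ a, tbl a = some e) ∧
        (∀ e, best = some e → ∃ e', betterEntry tie tbl best c = some e' ∧ e.value ≤ e'.value) ∧
        ∀ e, tbl c = some e → ∃ e', betterEntry tie tbl best c = some e' ∧
          e.value ≤ e'.value := by
      unfold betterEntry
      cases hc : tbl c with
      | none => exact ⟨fun e h => Or.inl h, fun e h => ⟨e, h, le_rfl⟩, by simp⟩
      | some e₀ =>
        cases best with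
        | none => simp; exact ⟨c, hc⟩
        | some b =>
          simp only
          split_ifs with hb
          · simpa using ⟨Or.inr ⟨c, hc⟩, Entry.beats_le hb⟩
          · simpa using Entry.le_of_not_beats hb
    obtain ⟨s1, s2, s3⟩ := hs
    rw [List.foldl_cons]
    refine ⟨?_, ?_, ?_⟩
    · intro e he
      rcases h1 e he with h | h
      · exact s1 e h
      · exact Or.inr h
    · intro e he
      obtain ⟨e', h4, h5⟩ := s2 e he
      obtain ⟨e'', h6, h7⟩ := h2 e' h4
      exact ⟨e'', h6, h5.trans h7⟩
    · intro a ha e he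
      rcases List.mem_cons.1 ha with rfl | ha
      · obtain ⟨e', h4, h5⟩ := s3 e he
        obtain ⟨e'', h6, h7⟩ := h2 e' h4
        exact ⟨e'', h6, h5.trans h7⟩
      · exact h3 a ha e he

/-- The set returned by the dynamic program satisfies the boundary condition, and no set with a
feasible schedule has a larger value. -/
theorem dp_spec (hn : 0 < n) (C : ℕ) (tie : TieRule n) :
    (dp T C tie).val.Nodup ∧ BoundaryOK T C (dp T C tie).val.toFinset ∧
    ∀ S y, IsFeasible T C S y → welfare T S ≤ welfare T (dp T C tie).val.toFinset := by
  have h0 : IsFeasible T C ∅ fun _ _ => 0 := by simp [IsFeasible]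
  set e₀ : Entry n := ⟨[], 0, 0, (taskSegs T).map fun _ => 0⟩ with he₀
  set A₀ : Table n := Function.update (fun _ => none) 0 (some e₀) with hA₀
  have hval₀ : e₀.Valid T C ∅ := by
    refine ⟨by simp [he₀], by simp [he₀], by simp [he₀, welfare], by simp [he₀, dem],
      by simp [he₀, lam], ?_⟩
    simpa [he₀] using h0.boundaryOK hn (Finset.empty_subset _)
  have hA : TableValid T C ∅ A₀ := by
    intro a e h
    by_cases ha : a = 0
    · subst ha
      obtain rfl : e₀ = e := by simpa [hA₀] using h
      exact ⟨hval₀, by simpa [he₀] using (cell_empty T C).symm⟩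
    · simp [hA₀, Function.update_of_ne ha] at h
  have hAc : ∀ S, TableComplete T C S ∅ A₀ := by
    intro S O hO _
    obtain rfl := Finset.subset_empty.1 hO
    refine ⟨e₀, by simp [cell_empty, hA₀], by simp [welfare, he₀]⟩
  set A := (List.finRange n).foldl (fun tbl j => (dpRound T C tie (horizon T) (taskSegs T)
      (tableSize C (taskSegs T)).val tbl j).val) A₀ with hAdef
  have key : ∀ S, (∀ O ⊆ S, BoundaryOK T C O) →
      TableValid T C Finset.univ A ∧ TableComplete T C S Finset.univ A := by
    intro S hS
    have := dpRound_foldl_spec (tie := tie) hn hS (List.nodup_finRange n) (by simp) hA (hAc S)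
    simpa [List.toFinset_finRange] using this
  obtain ⟨hval, hcomp⟩ := key ∅ fun O hO => h0.boundaryOK hn hO
  have hdp : (dp T C tie).val = match (bestEntry tie (tableSize C (taskSegs T)).val A).val with
      | some e => e.tasks
      | none => [] := by
    simp only [dp, Timed.val_bind, Timed.val_foldlM, deadlines_headD T hn]
    change (match (bestEntry tie (tableSize C (taskSegs T)).val A).val with
      | some e => step e.tasks
      | none => step []).val = _
    split <;> rfl
  obtain ⟨b1, -, b3⟩ := betterEntry_foldl_spec tie A
    (List.range (tableSize C (taskSegs T)).val) none
  rw [← bestEntry_val] at b1 b3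
  have hbest : ∀ S y, IsFeasible T C S y → ∃ e,
      (bestEntry tie (tableSize C (taskSegs T)).val A).val = some e ∧ welfare T S ≤ e.value := by
    intro S y hS
    obtain ⟨-, hc⟩ := key S fun O hO => hS.boundaryOK hn hO
    obtain ⟨e, he, hw⟩ := hc S (Finset.subset_univ _) subset_rfl
    obtain ⟨e', he', hw'⟩ := b3 _ (List.mem_range.2 (cell_lt T C S)) e he
    exact ⟨e', he', hw.trans hw'⟩
  obtain ⟨e, he, -⟩ := hbest ∅ _ h0
  rw [he] at hdp
  have hve : e.Valid T C Finset.univ := by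
    rcases b1 e he with h | ⟨a, ha⟩
    · simp at h
    · exact (hval a e ha).1
  simp only at hdp
  rw [hdp]
  refine ⟨hve.nodup, hve.boundary, ?_⟩
  intro S y hS
  obtain ⟨e', he', hw⟩ := hbest S y hS
  rw [he] at he'
  obtain rfl := Option.some.inj he'
  rw [← hve.value_eq]
  exact hw

end

section

/-! ### Allocations -/

section Alloc

variable {n : ℕ}

theorem Alloc.give_y (A : Alloc n) (i j : Fin n) (s r t : ℕ) :
    (A.give i s r).y j t = A.y j t + if j = i ∧ t = s then r else 0 := by
  unfold Alloc.give
  by_cases h : j = i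
  · subst h
    by_cases h' : t = s
    · subst h'; simp
    · simp [h']
  · simp [h]

theorem Alloc.take_y (A : Alloc n) (i j : Fin n) (s r t : ℕ) :
    (A.take i s r).y j t = A.y j t - if j = i ∧ t = s then r else 0 := by
  unfold Alloc.take
  by_cases h : j = i
  · subst h
    by_cases h' : t = s
    · subst h'; simp
    · simp [h']
  · simp [h]

theorem Alloc.give_avail (A : Alloc n) (i : Fin n) (s r t : ℕ) :
    (A.give i s r).avail t = A.avail t - if t = s then r else 0 := by
  unfold Alloc.give
  by_cases h : t = s
  · subst h; simp
  · simp [h]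

theorem Alloc.take_avail (A : Alloc n) (i : Fin n) (s r t : ℕ) :
    (A.take i s r).avail t = A.avail t + if t = s then r else 0 := by
  unfold Alloc.take
  by_cases h : t = s
  · subst h; simp
  · simp [h]

@[simp] theorem Alloc.give_zero (A : Alloc n) (i : Fin n) (s : ℕ) : A.give i s 0 = A := by
  simp [Alloc.give]

@[simp] theorem Alloc.take_zero (A : Alloc n) (i : Fin n) (s : ℕ) : A.take i s 0 = A := by
  simp [Alloc.take]

theorem Alloc.sum_give (A : Alloc n) (i : Fin n) (s r t : ℕ) :
    ∑ j, (A.give i s r).y j t = ∑ j, A.y j t + if t = s then r else 0 := by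
  simp only [Alloc.give_y, Finset.sum_add_distrib]
  by_cases h : t = s <;> simp [h]

theorem Alloc.sum_take (A : Alloc n) (i : Fin n) {s r : ℕ} (hr : r ≤ A.y i s) (t : ℕ) :
    (∑ j, (A.take i s r).y j t) + (if t = s then r else 0) = ∑ j, A.y j t := by
  have : ∀ j, A.y j t = (A.take i s r).y j t + if j = i ∧ t = s then r else 0 := by
    intro j
    rw [Alloc.take_y]
    split_ifs with h
    · obtain ⟨rfl, rfl⟩ := h; omega
    · omega
  rw [Finset.sum_congr rfl fun j _ => this j, Finset.sum_add_distrib]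
  by_cases h : t = s <;> simp [h]

theorem Alloc.row_give (A : Alloc n) (i : Fin n) (s r : ℕ) (I : Finset ℕ) :
    ∑ t ∈ I, (A.give i s r).y i t = (∑ t ∈ I, A.y i t) + if s ∈ I then r else 0 := by
  simp only [Alloc.give_y, Finset.sum_add_distrib, true_and, Finset.sum_ite_eq']

theorem Alloc.row_take (A : Alloc n) (i : Fin n) {s r : ℕ} (hr : r ≤ A.y i s) (I : Finset ℕ) :
    (∑ t ∈ I, (A.take i s r).y i t) + (if s ∈ I then r else 0) = ∑ t ∈ I, A.y i t := by
  have : ∀ t, A.y i t = (A.take i s r).y i t + if t = s then r else 0 := by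
    intro t
    rw [Alloc.take_y]
    by_cases h : t = s
    · subst h; simp; omega
    · simp [h]
  rw [Finset.sum_congr rfl fun j _ => this j, Finset.sum_add_distrib]
  simp

end Alloc

/-- The sum of `f` over the time slots before `t`. -/
def sumBefore (f : ℕ → ℕ) (t : ℕ) : ℕ := ∑ u ∈ Finset.Ico 1 t, f u

theorem sumBefore_mono (f : ℕ → ℕ) : Monotone (sumBefore f) := fun _ _ h =>
  Finset.sum_le_sum_of_subset (Finset.Ico_subset_Ico_right h)

theorem sumBefore_succ (f : ℕ → ℕ) {t : ℕ} (h : 1 ≤ t) :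
    sumBefore f (t + 1) = sumBefore f t + f t := Finset.sum_Ico_succ_top h f

theorem eq_zero_of_sumBefore {f : ℕ → ℕ} {t : ℕ} (h : sumBefore f t = 0) {u : ℕ} (h1 : 1 ≤ u)
    (h2 : u < t) : f u = 0 :=
  Finset.sum_eq_zero_iff.1 h u (Finset.mem_Ico.2 ⟨h1, h2⟩)

theorem prefixSum_val (f : ℕ → ℕ) (t : ℕ) : (prefixSum f t).val = sumBefore f (t + 1) := by
  induction t with
  | zero => simp [prefixSum, sumBefore]
  | succ t ih => rw [sumBefore_succ _ (by omega), ← ih]; rfl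

theorem latestFree_none {av : ℕ → ℕ} {t : ℕ} (h : (latestFree av t).val = none) :
    ∀ v, 1 ≤ v → v ≤ t → av v = 0 := by
  induction t with
  | zero => intro v h1 h2; omega
  | succ t ih =>
    simp only [latestFree, Timed.val_bind] at h
    split_ifs at h with hp
    · simp at h
    · intro v h1 h2
      rcases h2.eq_or_lt with rfl | h2
      · omega
      · exact ih h v h1 (by omega)

theorem latestFree_some {av : ℕ → ℕ} {t t' : ℕ} (h : (latestFree av t).val = some t') :
    1 ≤ t' ∧ t' ≤ t ∧ 0 < av t' ∧ ∀ v, t' < v → v ≤ t → av v = 0 := by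
  induction t with
  | zero => simp [latestFree] at h
  | succ t ih =>
    simp only [latestFree, Timed.val_bind] at h
    split_ifs at h with hp
    · obtain rfl : t + 1 = t' := by simpa using h
      exact ⟨by omega, le_rfl, hp, fun v h1 h2 => by omega⟩
    · obtain ⟨h1, h2, h3, h4⟩ := ih h
      refine ⟨h1, by omega, h3, fun v h5 h6 => ?_⟩
      rcases h6.eq_or_lt with rfl | h6
      · omega
      · exact h4 v h5 (by omega)

theorem mem_candidates {n : ℕ} {A : Alloc n} {t t' : ℕ} {l : List (Fin n)} {j : Fin n} :
    j ∈ (candidates A t t' l).val ↔ j ∈ l ∧ A.y j t' < A.y j t := by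
  induction l with
  | nil => simp [candidates]
  | cons a l ih =>
    simp only [candidates, Timed.val_bind, val_step, List.mem_cons]
    split_ifs with h
    · rw [List.mem_cons, ih]
      constructor
      · rintro (rfl | ⟨h1, h2⟩)
        · exact ⟨Or.inl rfl, h⟩
        · exact ⟨Or.inr h1, h2⟩
      · rintro ⟨rfl | h1, h2⟩
        · exact Or.inl rfl
        · exact Or.inr ⟨h1, h2⟩
    · rw [ih]
      constructor
      · rintro ⟨h1, h2⟩; exact ⟨Or.inr h1, h2⟩
      · rintro ⟨rfl | h1, h2⟩
        · exact absurd h2 h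
        · exact ⟨h1, h2⟩

theorem withDeadline_val {n : ℕ} (T : Fin n → MTask) (τ : ℕ) (l : List (Fin n)) :
    (withDeadline T τ l).val = l.filter fun i => (T i).deadline = τ := by
  induction l with
  | nil => rfl
  | cons a l ih =>
    simp only [withDeadline, Timed.val_bind, val_step, ih, List.filter_cons, decide_eq_true_eq]

/-! ### The invariants of latest deadline first -/

variable {n : ℕ} (T : Fin n → MTask)

/-- Task `j` is served from `v` on at its parallelism bound, or it receives nothing before `v`: in
either case no more of its demand can be served from `v` on. -/
def Late (A : Alloc n) (v : ℕ) (j : Fin n) : Prop :=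
  (∀ u, v ≤ u → u ≤ (T j).deadline → A.y j u = (T j).bound) ∨ ∀ u, u < v → A.y j u = 0

/-- The state after the tasks of `F` have been treated: they are exactly served, machines are free
preferably at early time slots, and a time slot is free only if every task is late there.  `cur` is
a bound for the deadlines of the tasks still to be treated. -/
structure Good (C : ℕ) (F : Finset (Fin n)) (cur : ℕ) (A : Alloc n) : Prop where
  total : ∀ t, A.avail t + ∑ j, A.y j t = C
  le_bound : ∀ j t, A.y j t ≤ (T j).bound
  support : ∀ j t, A.y j t ≠ 0 → j ∈ F ∧ 1 ≤ t ∧ t ≤ (T j).deadline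
  served : ∀ j ∈ F, ∑ t ∈ Finset.Icc 1 (T j).deadline, A.y j t = (T j).demand
  anti : ∀ t, 1 ≤ t → (t + 1 ≤ cur ∨ ¬ IsDeadline T t) → A.avail (t + 1) ≤ A.avail t
  late : ∀ v, 1 ≤ v → 0 < A.avail v → ∀ j ∈ F, Late T A v j

/-- The part of the invariant that holds all the time while task `i` is treated after the tasks of
`F`.  The slot `t` is exempted: machines that are made free there are about to be given to `i`. -/
structure Mid (C : ℕ) (F : Finset (Fin n)) (i : Fin n) (t : ℕ) (A : Alloc n) : Prop where
  total : ∀ t, A.avail t + ∑ j, A.y j t = C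
  le_bound : ∀ j t, A.y j t ≤ (T j).bound
  support : ∀ j t, A.y j t ≠ 0 → j ∈ insert i F ∧ 1 ≤ t ∧ t ≤ (T j).deadline
  served : ∀ j ∈ F, ∑ t ∈ Finset.Icc 1 (T j).deadline, A.y j t = (T j).demand
  anti : ∀ t, (T i).deadline < t → ¬ IsDeadline T t → A.avail (t + 1) ≤ A.avail t
  late : ∀ v, 1 ≤ v → v ≠ t → 0 < A.avail v → ∀ j ∈ F, Late T A v j

variable {T} {C : ℕ} {F : Finset (Fin n)} {i : Fin n} {t : ℕ} {A : Alloc n}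

theorem Mid.give (h : Mid T C F i t A) (hi : i ∉ F) {s r : ℕ} (h1 : 1 ≤ s)
    (h2 : s ≤ (T i).deadline) (hr : r ≤ A.avail s) (hb : A.y i s + r ≤ (T i).bound) :
    Mid T C F i t (A.give i s r) := by
  have hF : ∀ j ∈ F, j ≠ i := by rintro j hj rfl; exact hi hj
  have hy : ∀ j ∈ F, (A.give i s r).y j = A.y j := fun j hj => by
    funext u; simp [Alloc.give_y, hF j hj]
  refine ⟨?_, ?_, ?_, ?_, ?_, ?_⟩
  · intro u
    rw [Alloc.sum_give, Alloc.give_avail, ← h.total u]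
    split_ifs with hu
    · subst hu; omega
    · omega
  · intro j u
    rw [Alloc.give_y]
    split_ifs with hu
    · obtain ⟨rfl, rfl⟩ := hu; exact hb
    · exact h.le_bound j u
  · intro j u
    rw [Alloc.give_y]
    split_ifs with hu
    · obtain ⟨rfl, rfl⟩ := hu
      exact fun _ => ⟨Finset.mem_insert_self _ _, h1, h2⟩
    · exact h.support j u
  · intro j hj
    rw [hy j hj]; exact h.served j hj
  · intro u hu hd
    rw [Alloc.give_avail, Alloc.give_avail, if_neg (by omega), if_neg (by omega)]
    exact h.anti u hu hd
  · intro v hv1 hvt hv j hj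
    rw [Alloc.give_avail] at hv
    have := h.late v hv1 hvt (by omega) j hj
    rwa [Late, ← hy j hj] at this

/-- The exemption of the slot `t` ends when all its free machines have been given away. -/
theorem Mid.close (h : Mid T C F i t A) (h0 : A.avail t = 0) (t' : ℕ) : Mid T C F i t' A :=
  ⟨h.total, h.le_bound, h.support, h.served, h.anti, fun v h1 _ hv => h.late v h1
    (by rintro rfl; omega) hv⟩

theorem Mid.exempt (h : Mid T C F i 0 A) (t' : ℕ) : Mid T C F i t' A :=
  ⟨h.total, h.le_bound, h.support, h.served, h.anti, fun v h1 _ hv => h.late v h1 (by omega) hv⟩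

theorem Mid.take (h : Mid T C F i t A) (hi : i ∉ F) {s r : ℕ} (h2 : s ≤ (T i).deadline)
    (hr : r ≤ A.y i s) (ha : 0 < r → 0 < A.avail s) : Mid T C F i t (A.take i s r) := by
  have hF : ∀ j ∈ F, j ≠ i := by rintro j hj rfl; exact hi hj
  have hy : ∀ j ∈ F, (A.take i s r).y j = A.y j := fun j hj => by
    funext u; simp [Alloc.take_y, hF j hj]
  refine ⟨?_, ?_, ?_, ?_, ?_, ?_⟩
  · intro u
    have := A.sum_take i hr u
    rw [Alloc.take_avail, ← h.total u]
    omega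
  · intro j u
    rw [Alloc.take_y]
    exact (Nat.sub_le _ _).trans (h.le_bound j u)
  · intro j u hu
    rw [Alloc.take_y] at hu
    exact h.support j u (by omega)
  · intro j hj
    rw [hy j hj]; exact h.served j hj
  · intro u hu hd
    rw [Alloc.take_avail, Alloc.take_avail, if_neg (by omega), if_neg (by omega)]
    exact h.anti u hu hd
  · intro v hv1 hvt hv j hj
    rw [Alloc.take_avail] at hv
    have hv' : 0 < A.avail v := by
      split_ifs at hv with hvs
      · subst hvs; omega
      · omega
    have := h.late v hv1 hvt hv' j hj
    rwa [Late, ← hy j hj] at this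

/-- Moving one machine's worth of work of `j` from `t` to the latest free slot `t'` before `t`
keeps the invariant: `j` is late at `t'`, but not at its bound at `t'`, so it has nothing before
`t'`, and no slot after `t'` is free. -/
theorem Mid.move (h : Mid T C F i t A) (hFd : ∀ j ∈ F, (T i).deadline ≤ (T j).deadline)
    {t' : ℕ} {j : Fin n} (hj : j ∈ F) (ht' : 1 ≤ t') (htt : t' < t) (htd : t ≤ (T i).deadline)
    (hlt : A.y j t' < A.y j t) (hpos : 0 < A.avail t')
    (hz : ∀ v, t' < v → v ≤ (T i).deadline → v ≠ t → A.avail v = 0) :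
    Mid T C F i t ((A.take j t 1).give j t' 1) := by
  have hdj := hFd j hj
  have hy : ∀ j', j' ≠ j → ((A.take j t 1).give j t' 1).y j' = A.y j' := fun j' hj' => by
    funext u; simp [Alloc.give_y, Alloc.take_y, hj']
  have hyj : ∀ u, u ≠ t → u ≠ t' → ((A.take j t 1).give j t' 1).y j u = A.y j u := by
    intro u h1 h2
    simp [Alloc.give_y, Alloc.take_y, h1, h2]
  have hone : 1 ≤ A.y j t := by omega
  refine ⟨?_, ?_, ?_, ?_, ?_, ?_⟩
  · intro u
    have := A.sum_take j hone u
    have h2 := h.total u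
    rw [Alloc.sum_give, Alloc.give_avail, Alloc.take_avail]
    split_ifs at this ⊢ with h3 h4 h4
    · omega
    · omega
    · subst h4; omega
    · omega
  · intro j' u
    have h1 := h.le_bound j' u
    rw [Alloc.give_y, Alloc.take_y]
    by_cases hu : j' = j ∧ u = t'
    · rw [if_pos hu]
      obtain ⟨rfl, rfl⟩ := hu
      have := h.le_bound j' t
      omega
    · rw [if_neg hu]; omega
  · intro j' u hu
    rw [Alloc.give_y, Alloc.take_y] at hu
    by_cases hu' : j' = j ∧ u = t'
    · obtain ⟨rfl, rfl⟩ := hu'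
      exact ⟨Finset.mem_insert_of_mem hj, ht', by omega⟩
    · rw [if_neg hu'] at hu
      exact h.support j' u (by omega)
  · intro j' hj'
    by_cases hjj : j' = j
    · subst hjj
      rw [Alloc.row_give, ← h.served j' hj', ← A.row_take j' hone, if_pos, if_pos]
      · exact Finset.mem_Icc.2 ⟨by omega, by omega⟩
      · exact Finset.mem_Icc.2 ⟨by omega, by omega⟩
    · rw [hy j' hjj]; exact h.served j' hj'
  · intro u hu hd
    simp only [Alloc.give_avail, Alloc.take_avail]
    rw [if_neg (by omega), if_neg (by omega), if_neg (by omega), if_neg (by omega)]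
    exact h.anti u hu hd
  · intro v hv1 hvt hv j' hj'
    have hv' : 0 < A.avail v := by
      rw [Alloc.give_avail, Alloc.take_avail, if_neg hvt] at hv
      omega
    have hold := h.late v hv1 hvt hv' j' hj'
    by_cases hjj : j' = j
    · subst hjj
      by_cases hvd : v ≤ (T i).deadline
      · have hvt' : v ≤ t' := by
          by_contra hc
          have := hz v (by omega) hvd hvt
          omega
        right
        have : ∀ u, u < t' → A.y j' u = 0 := by
          rcases h.late t' ht' (by omega) hpos j' hj' with h1 | h1
          · have h2 := h1 t' le_rfl (by omega)
            have := h.le_bound j' t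
            omega
          · exact h1
        intro u hu
        rw [hyj u (by omega) (by omega)]
        exact this u (by omega)
      · rcases hold with h1 | h1
        · left
          intro u hu1 hu2
          rw [hyj u (by omega) (by omega)]
          exact h1 u hu1 hu2
        · have := h1 t (by omega)
          omega
    · rwa [Late, ← hy j' hjj] at hold

/-! ### Using the boundary condition -/

/-- In a set that satisfies the boundary condition, every task can be completed on its own. -/
theorem BoundaryOK.demand_le (hn : 0 < n) {S : Finset (Fin n)} (h : BoundaryOK T C S) :
    ∀ j ∈ S, (T j).demand ≤ (T j).bound * (T j).deadline := by
  have h1 := h.dem_eq hn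
  have h2 := sum_hvec_le (C := C) (f := lam T S) (fun c => lam_anti T S (Nat.zero_le c)) (taskSegs T)
    (Nat.zero_le _)
  have h3 : dem T S = lam T S 0 := le_antisymm (by rw [h1, hv]; omega) (lam_le T S 0)
  intro j hj
  have := (Finset.sum_eq_sum_iff_of_le fun j _ => (T j).contribution_le 0).1 h3.symm j hj
  rw [MTask.contribution_eq_min] at this
  simpa using this

/-- If no machine is left up to the deadline of `i`, then `i` is completely served: the machines
after this deadline are used as much as the treated tasks permit, and the boundary condition
bounds the remaining demand. -/
theorem Mid.demand_le (hn : 0 < n) {S : Finset (Fin n)} (hS : BoundaryOK T C S)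
    (h : Mid T C F i t A) (ht : t ≤ (T i).deadline) (hi : i ∉ F) (hiS : i ∈ S) (hFS : F ⊆ S)
    (hFi : ∀ j ∈ S, (T i).deadline < (T j).deadline → j ∈ F)
    (hz : ∀ v, 1 ≤ v → v ≤ (T i).deadline → A.avail v = 0) :
    (T i).demand ≤ ∑ t ∈ Finset.Icc 1 (T i).deadline, A.y i t := by
  set h' := horizon T with hh
  set d := (T i).deadline with hd
  have hdh : d ≤ h' := deadline_le_horizon T i
  let G : ℕ → ℕ := fun c => ∑ t ∈ Finset.Ioc c h', ∑ j, A.y j t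
  have hGs : ∀ c e, c ≤ e → e ≤ h' → G c = (∑ t ∈ Finset.Ioc c e, ∑ j, A.y j t) + G e := by
    intro c e h1 h2
    exact (Finset.sum_Ioc_consecutive _ h1 h2).symm
  have hGm : Antitone G := fun a b hab =>
    Finset.sum_le_sum_of_subset (Finset.Ioc_subset_Ioc_left hab)
  have hrow : ∀ j c, ∑ t ∈ Finset.Ioc c h', A.y j t =
      ∑ t ∈ Finset.Ioc c (T j).deadline, A.y j t := by
    intro j c
    symm
    refine Finset.sum_subset (Finset.Ioc_subset_Ioc_right (deadline_le_horizon T j)) ?_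
    intro u h1 h2
    by_contra h3
    have := h.support j u h3
    simp only [Finset.mem_Ioc] at h1 h2
    omega
  have hIcc : ∀ e, Finset.Icc 1 e = Finset.Ioc 0 e := by intro e; ext; simp; omega
  have hfull : ∀ a b, (∀ v, a < v → v ≤ b → A.avail v = 0) →
      ∑ t ∈ Finset.Ioc a b, ∑ j, A.y j t = C * (b - a) := by
    intro a b hab
    rw [Finset.sum_congr rfl fun v hv => ?_, Finset.sum_const, Nat.card_Ioc, smul_eq_mul, mul_comm]
    have := h.total v
    have := hab v (Finset.mem_Ioc.1 hv).1 (Finset.mem_Ioc.1 hv).2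
    omega
  have hlam : ∀ s, d ≤ s → 0 < A.avail (s + 1) → lam T S s ≤ G s := by
    intro s hs hpos
    have h1 : lam T S s = lam T F s := by
      symm
      refine Finset.sum_subset hFS fun j hj hjF => MTask.contribution_eq_zero _ ?_
      by_contra hc
      exact hjF (hFi j hj (by omega))
    rw [h1]
    simp only [G]
    rw [Finset.sum_comm]
    refine le_trans (Finset.sum_le_sum fun j hj => ?_)
      (Finset.sum_le_sum_of_subset (Finset.subset_univ F))
    rw [hrow, MTask.contribution_eq_min]
    rcases h.late (s + 1) (by omega) (by omega) hpos j hj with hl | hl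
    · refine (min_le_right _ _).trans ?_
      rw [Finset.sum_congr rfl fun u hu =>
        hl u (by simp only [Finset.mem_Ioc] at hu; omega) (Finset.mem_Ioc.1 hu).2]
      simp [mul_comm]
    · refine (min_le_left _ _).trans ?_
      rw [← h.served j hj, hIcc]
      refine le_of_eq (Finset.sum_subset_zero_on_sdiff (f := A.y j) (g := A.y j)
        (Finset.Ioc_subset_Ioc_left (Nat.zero_le s)) ?_ fun _ _ => rfl).symm
      intro u hu
      simp only [Finset.mem_sdiff, Finset.mem_Ioc] at hu
      exact hl u (by omega)
  have hGmin : ∀ s w, d ≤ s → (∀ t, s < t → t < s + w → ¬ IsDeadline T t) → s + w ≤ h' →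
      min (lam T S s) (G (s + w) + C * w) ≤ G s := by
    intro s w hs hnd hsw
    by_cases hpos : 0 < A.avail (s + 1)
    · exact (min_le_left _ _).trans (hlam s hs hpos)
    · refine (min_le_right _ _).trans ?_
      rw [hGs s (s + w) (by omega) hsw, hfull]
      · rw [Nat.add_sub_cancel_left]; omega
      · intro v hv1 hv2
        obtain ⟨m, rfl⟩ := Nat.exists_eq_add_of_lt hv1
        clear hv1
        induction m with
        | zero => simpa using Nat.eq_zero_of_not_pos hpos
        | succ m ih =>
          have h1 := ih (by omega)
          have h2 := h.anti (s + m + 1) (by omega) (hnd _ (by omega) (by omega))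
          have : s + (m + 1) + 1 = s + m + 1 + 1 := by ring
          rw [this]; omega
  have hbd := (boundary_val_iff _ _ _ _ _).1 hS
  have hDG : dem T S ≤ C * d + G d := by
    rcases hdh.eq_or_lt with heq | hlt
    · rw [heq]; exact hbd.1.trans (Nat.le_add_right _ _)
    · exact demand_le_of_boundaryFrom (taskSegs_chain T hn) ⟨i, rfl⟩ hlt (T i).deadline_pos
        (Nat.zero_le _) hGmin hGm hbd.2
  have hG0 : G 0 = C * d + G d := by
    rw [hGs 0 d (Nat.zero_le _) hdh, hfull 0 d fun v h1 h2 => hz v h1 h2, Nat.sub_zero]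
  have hsum : G 0 = dem T F + ∑ t ∈ Finset.Icc 1 d, A.y i t := by
    simp only [G]
    rw [Finset.sum_comm, Finset.sum_congr rfl fun j _ => hrow j 0,
      ← Finset.sum_subset (Finset.subset_univ (insert i F)), Finset.sum_insert hi, add_comm, hIcc,
      Finset.sum_congr rfl fun j hj => ?_]
    · rfl
    · rw [← h.served j hj, hIcc]
    · intro j _ hj
      refine Finset.sum_eq_zero fun u _ => ?_
      by_contra h3
      exact hj (h.support j u h3).1
  have hdem : dem T F + (T i).demand ≤ dem T S := by
    rw [← dem_insert T hi]
    exact Finset.sum_le_sum_of_subset (Finset.insert_subset hiS hFS)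
  omega

end

section

/-! ### The exchange routine -/

variable {n : ℕ} {T : Fin n → MTask} {C : ℕ} {F : Finset (Fin n)} {i : Fin n} {t : ℕ}
  {A : Alloc n}

/-- If the machines not used by the other tasks (`W + f`) become fewer with time and the task with
allocation `f` takes as much as possible except at its first slot, then free machines become fewer
with time. -/
theorem avail_anti {W f : ℕ → ℕ} {k b : ℕ}
    (hU : ∀ v, 1 ≤ v → v + 1 ≤ b → W (v + 1) + f (v + 1) ≤ W v + f v)
    (hb : ∀ u, 1 ≤ u → u ≤ b → f u = k ∨ W u = 0 ∨ sumBefore f u = 0) (hk : ∀ u, f u ≤ k)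
    (v : ℕ) (h1 : 1 ≤ v) (h2 : v + 1 ≤ b) : W (v + 1) ≤ W v := by
  have hu := hU v h1 h2
  have hk1 := hk v
  have hk2 := hk (v + 1)
  have hz : sumBefore f (v + 1) = 0 → f v = 0 := fun h => eq_zero_of_sumBefore h h1 (by omega)
  rcases hb (v + 1) (by omega) h2 with h3 | h3 | h3
  · omega
  · omega
  · have := hz h3
    omega

theorem le_of_anti {W : ℕ → ℕ} {b : ℕ} (h : ∀ v, 1 ≤ v → v + 1 ≤ b → W (v + 1) ≤ W v) {u v : ℕ}
    (hu : 1 ≤ u) (huv : u ≤ v) (hv : v ≤ b) : W v ≤ W u := by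
  induction v, huv using Nat.le_induction with
  | base => exact le_rfl
  | succ v huv ih => exact (h v (by omega) hv).trans (ih (by omega))

/-- The invariant of the routine at the slot `t`; `f` is the allocation of task `i`, which the
routine does not change.  The last field concerns the mode `η = true`, in which the machines made
free at `t` will be given to `i` in exchange for machines at its earliest slots: the slots that
lose machines are free before. -/
structure RoutineInv (T : Fin n → MTask) (C : ℕ) (F : Finset (Fin n)) (i : Fin n) (t : ℕ)
    (η : Bool) (Δ : ℕ) (f : ℕ → ℕ) (A : Alloc n) : Prop where
  mid : Mid T C F i t A
  row : A.y i = f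
  zero_after : ∀ v, t < v → v ≤ (T i).deadline → A.avail v = 0
  anti : ∀ v, 1 ≤ v → v + 1 < t → A.avail (v + 1) + f (v + 1) ≤ A.avail v + f v
  full : ∀ u, 1 ≤ u → u < t → 0 < A.avail u → (η = true → 0 < sumBefore f u) → f u = (T i).bound
  le : A.avail t ≤ Δ
  debt : η = true → ∀ v, 1 ≤ v → v < t → sumBefore f v < A.avail t → 0 < A.avail v

/-- The situations in which the routine stops. -/
def RoutineExit (t : ℕ) (η : Bool) (Δ : ℕ) (f : ℕ → ℕ) (A : Alloc n) : Prop :=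
  A.avail t = Δ ∨ (∀ v, 1 ≤ v → v < t → A.avail v = 0) ∨
    (η = true ∧ ∃ t' < t, (∀ v, t' < v → v < t → A.avail v = 0) ∧ sumBefore f t' ≤ A.avail t)

/-- If `i` is at its bound at `t'` and fewer than `k_i - y_i(t)` machines are free at `t`, then
some other task has more machines at `t` than at `t'`. -/
theorem Mid.exists_candidate (h : Mid T C F i t A) {t' : ℕ} (hk : A.y i t' = (T i).bound)
    (hpos : 0 < A.avail t') (hlt : A.avail t < (T i).bound - A.y i t) :
    ∃ j ∈ F, A.y j t' < A.y j t := by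
  by_contra hc
  push Not at hc
  have h1 : ∑ j ∈ Finset.univ.erase i, A.y j t ≤ ∑ j ∈ Finset.univ.erase i, A.y j t' := by
    refine Finset.sum_le_sum fun j hj => ?_
    by_cases hjF : j ∈ F
    · exact hc j hjF
    · have : A.y j t = 0 := by
        by_contra h3
        rcases Finset.mem_insert.1 (h.support j t h3).1 with h4 | h4
        · exact (Finset.mem_erase.1 hj).1 h4
        · exact hjF h4
      omega
  have h2 := Finset.add_sum_erase Finset.univ (fun j => A.y j t) (Finset.mem_univ i)
  have h3 := Finset.add_sum_erase Finset.univ (fun j => A.y j t') (Finset.mem_univ i)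
  have h4 := h.total t
  have h5 := h.total t'
  omega

theorem RoutineInv.move {η : Bool} {Δ : ℕ} {f : ℕ → ℕ} (h : RoutineInv T C F i t η Δ f A)
    (hi : i ∉ F) (hFd : ∀ j ∈ F, (T i).deadline ≤ (T j).deadline) (htd : t ≤ (T i).deadline)
    (hlt : A.avail t < Δ) {t' : ℕ} (h1 : 1 ≤ t') (h2 : t' < t) (hpos : 0 < A.avail t')
    (hz : ∀ v, t' < v → v < t → A.avail v = 0) (hη : η = true → A.avail t < sumBefore f t')
    {j : Fin n} (hj : j ∈ F) (hjt : A.y j t' < A.y j t) :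
    RoutineInv T C F i t η Δ f ((A.take j t 1).give j t' 1) ∧
      ((A.take j t 1).give j t' 1).avail t = A.avail t + 1 := by
  have hji : j ≠ i := by rintro rfl; exact hi hj
  have hk : f t' = (T i).bound := h.full t' h1 h2 hpos fun hη' => by have := hη hη'; omega
  have hav : ∀ v, ((A.take j t 1).give j t' 1).avail v =
      if v = t then A.avail t + 1 else if v = t' then A.avail t' - 1 else A.avail v := by
    intro v
    rw [Alloc.give_avail, Alloc.take_avail]
    split_ifs with h3 h4 h4
    · omega
    · subst h3; omega
    · subst h4; omega
    · omega
  have hft : ∀ u, f u ≤ (T i).bound := fun u => by rw [← h.row]; exact h.mid.le_bound i u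
  refine ⟨⟨?_, ?_, ?_, ?_, ?_, ?_, ?_⟩, by rw [hav, if_pos rfl]⟩
  · refine h.mid.move hFd hj h1 h2 htd hjt hpos fun v hv1 hv2 hvt => ?_
    rcases lt_or_gt_of_ne hvt with h3 | h3
    · exact hz v hv1 h3
    · exact h.zero_after v h3 hv2
  · rw [← h.row]
    funext u
    simp [Alloc.give_y, Alloc.take_y, hji.symm]
  · intro v hv1 hv2
    rw [hav, if_neg (by omega), if_neg (by omega)]
    exact h.zero_after v hv1 hv2
  · intro v hv1 hv2
    have h3 := h.anti v hv1 hv2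
    simp only [hav, if_neg (show ¬ v + 1 = t by omega), if_neg (show ¬ v = t by omega)]
    split_ifs with h4 h5 h5
    · omega
    · subst h4; omega
    · subst h5
      have := hz (v + 1) (by omega) hv2
      have := hft (v + 1)
      omega
    · exact h3
  · intro u hu1 hu2 hu3 hu4
    rw [hav, if_neg (by omega)] at hu3
    refine h.full u hu1 hu2 ?_ hu4
    split_ifs at hu3 with h3
    · subst h3; exact hpos
    · exact hu3
  · rw [hav, if_pos rfl]; omega
  · intro hη' v hv1 hv2 hv3
    rw [hav, if_pos rfl] at hv3
    have h3 := hη hη'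
    have hvt' : v < t' := by
      by_contra hc
      have := sumBefore_mono f (show t' ≤ v by omega)
      omega
    rw [hav, if_neg (by omega), if_neg (by omega)]
    have hanti := avail_anti (W := A.avail) (f := f) (k := (T i).bound) (b := t - 1)
      (fun v hv1 hv2 => h.anti v hv1 (by omega))
      (fun u hu1 hu2 => by
        by_cases hu3 : 0 < A.avail u
        · by_cases hu4 : 0 < sumBefore f u
          · exact Or.inl (h.full u hu1 (by omega) hu3 fun _ => hu4)
          · exact Or.inr (Or.inr (by omega))
        · exact Or.inr (Or.inl (by omega))) hft
    have := le_of_anti hanti hv1 hvt'.le (by omega)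
    omega

/-- The routine keeps its invariant, and it stops only because it reached `Δ`, found no free slot,
or met the stopping rule of the mode `η = true`: a task to be moved always exists and is never `i`
itself. -/
theorem routine_spec {pick : PickRule n} {S : List (Fin n)} (hi : i ∉ F) (hFS : ∀ j ∈ F, j ∈ S)
    (hFd : ∀ j ∈ F, (T i).deadline ≤ (T j).deadline)
    (htd : t ≤ (T i).deadline) {η : Bool} {Δ : ℕ} {f : ℕ → ℕ} (hΔ : Δ ≤ (T i).bound - f t)
    (fuel : ℕ) (A : Alloc n) (h : RoutineInv T C F i t η Δ f A) (hf : Δ ≤ fuel + A.avail t) :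
    RoutineInv T C F i t η Δ f (routine pick S i t Δ η fuel A).val ∧
      RoutineExit t η Δ f (routine pick S i t Δ η fuel A).val := by
  induction fuel generalizing A with
  | zero =>
    refine ⟨h, Or.inl ?_⟩
    have := h.le
    simp only [routine, val_step]
    omega
  | succ fuel ih =>
    have hle := h.le
    simp only [routine, Timed.val_bind]
    split_ifs with h1
    · exact ⟨h, Or.inl (by simp only [val_step]; omega)⟩
    simp only [Timed.val_bind]
    cases hfree : (latestFree A.avail (t - 1)).val with
    | none =>
      exact ⟨h, Or.inr (Or.inl fun v hv1 hv2 => latestFree_none hfree v hv1 (by omega))⟩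
    | some t' =>
      obtain ⟨g1, g2, g3, g4⟩ := latestFree_some hfree
      have hz : ∀ v, t' < v → v < t → A.avail v = 0 := fun v hv1 hv2 => g4 v hv1 (by omega)
      simp only [Timed.val_bind, prefixSum_val, Nat.sub_add_cancel g1, h.row]
      split_ifs with h2
      · exact ⟨h, Or.inr (Or.inr ⟨h2.1, t', by omega, hz, h2.2⟩)⟩
      simp only [Timed.val_bind]
      have hη : η = true → A.avail t < sumBefore f t' := fun hη => by
        by_contra hc
        exact h2 ⟨hη, by omega⟩
      have hk : f t' = (T i).bound :=
        h.full t' g1 (by omega) g3 fun hη' => by have := hη hη'; omega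
      have hne : (candidates A t t' S).val ≠ [] := by
        obtain ⟨j, hj, hjt⟩ := h.mid.exists_candidate (t' := t') (by rw [h.row, hk]) g3
          (by rw [h.row]; omega)
        exact List.ne_nil_of_mem (mem_candidates.2 ⟨hFS j hj, hjt⟩)
      rw [dif_pos hne]
      simp only [Timed.val_bind, val_step]
      have hmem := mem_candidates.1 (pick A t t' (candidates A t t' S).val hne).2
      generalize (pick A t t' (candidates A t t' S).val hne).1 = j at hmem ⊢
      have hjF : j ∈ F := by
        have h3 := (h.mid.support j t (by omega)).1
        rcases Finset.mem_insert.1 h3 with rfl | h3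
        · have := h.mid.le_bound j t
          rw [h.row, hk] at hmem
          rw [h.row] at this
          omega
        · exact h3
      obtain ⟨m1, m2⟩ := h.move hi hFd htd (by omega) g1 (by omega) g3 hz hη hjF hmem.2
      exact ih _ m1 (by rw [m2]; omega)

/-- When nothing of task `i` precedes a free slot, the routine does nothing in the mode
`η = true`. -/
theorem routine_eq_self {pick : PickRule n} {S : List (Fin n)} {Δ : ℕ}
    (h : ∀ v, 1 ≤ v → v < t → A.avail v = 0 ∨ sumBefore (A.y i) v = 0) (fuel : ℕ) :
    (routine pick S i t Δ true fuel A).val = A := by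
  cases fuel with
  | zero => rfl
  | succ fuel =>
    simp only [routine, Timed.val_bind]
    split_ifs with h1
    · rfl
    simp only [Timed.val_bind]
    cases hfree : (latestFree A.avail (t - 1)).val with
    | none => rfl
    | some t' =>
      obtain ⟨g1, g2, g3, g4⟩ := latestFree_some hfree
      simp only [Timed.val_bind, prefixSum_val, Nat.sub_add_cancel g1]
      rw [if_pos]
      · rfl
      · rcases h t' g1 (by omega) with h2 | h2
        · omega
        · simp [h2]

/-! ### The three phases of serving one task -/

/-- The sum of the allocations of `i`. -/
def served (T : Fin n → MTask) (i : Fin n) (A : Alloc n) : ℕ :=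
  ∑ t ∈ Finset.Icc 1 (T i).deadline, A.y i t

theorem served_give {s r : ℕ} (h1 : 1 ≤ s) (h2 : s ≤ (T i).deadline) :
    served T i (A.give i s r) = served T i A + r := by
  rw [served, Alloc.row_give, if_pos (Finset.mem_Icc.2 ⟨h1, h2⟩)]; rfl

/-- After the greedy phase, task `i` has at each slot its bound or all free machines, except at its
first slot if it is completely served; `V` counts the machines not used by the other tasks. -/
theorem fullyUtilize_spec (hi : i ∉ F) (V : ℕ → ℕ) (t rem : ℕ) (A : Alloc n)
    (htd : t ≤ (T i).deadline) (h : Mid T C F i 0 A)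
    (hs : served T i A + rem = (T i).demand) (h0 : ∀ u, u ≤ t → A.y i u = 0)
    (hV : ∀ v, A.avail v + A.y i v = V v)
    (hb : ∀ u, t < u → u ≤ (T i).deadline → A.y i u = (T i).bound ∨ A.avail u = 0 ∨
      (rem = 0 ∧ sumBefore (A.y i) u = 0)) :
    let r := (fullyUtilize T i t rem A).val
    Mid T C F i 0 r.2 ∧ served T i r.2 + r.1 = (T i).demand ∧
    (∀ v, r.2.avail v + r.2.y i v = V v) ∧
    ∀ u, 1 ≤ u → u ≤ (T i).deadline → r.2.y i u = (T i).bound ∨ r.2.avail u = 0 ∨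
      (r.1 = 0 ∧ sumBefore (r.2.y i) u = 0) := by
  induction t generalizing rem A with
  | zero => exact ⟨h, hs, hV, fun u h1 h2 => hb u h1 h2⟩
  | succ t ih =>
    simp only [fullyUtilize, Timed.val_bind, val_step]
    generalize hr : min (T i).bound (min rem (A.avail (t + 1))) = r
    have hz := h0 (t + 1) le_rfl
    have hy : ∀ u, u ≠ t + 1 → (A.give i (t + 1) r).y i u = A.y i u := fun u hu => by
      simp [Alloc.give_y, hu]
    have hyt : (A.give i (t + 1) r).y i (t + 1) = r := by simp [Alloc.give_y, hz]
    have ha : ∀ u, u ≠ t + 1 → (A.give i (t + 1) r).avail u = A.avail u := fun u hu => by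
      simp [Alloc.give_avail, hu]
    have hat : (A.give i (t + 1) r).avail (t + 1) = A.avail (t + 1) - r := by
      simp [Alloc.give_avail]
    refine ih _ _ (by omega) (h.give hi (by omega) htd (by omega) (by omega)) ?_ ?_ ?_ ?_
    · rw [served_give (by omega) htd]; omega
    · intro u hu
      rw [hy u (by omega)]; exact h0 u (by omega)
    · intro v
      by_cases hv : v = t + 1
      · subst hv
        have := hV (t + 1)
        rw [hyt, hat]; omega
      · rw [hy v hv, ha v hv]; exact hV v
    · intro u hu1 hu2
      by_cases hu : u = t + 1
      · subst hu
        rw [hyt, hat]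
        by_cases hrem : r = rem
        · refine Or.inr (Or.inr ⟨by omega, ?_⟩)
          refine Finset.sum_eq_zero fun v hv => ?_
          rw [Finset.mem_Ico] at hv
          rw [hy v (by omega)]
          exact h0 v (by omega)
        · omega
      · rw [hy u hu, ha u hu]
        rcases hb u (by omega) hu2 with h1 | h1 | ⟨h1, h2⟩
        · exact Or.inl h1
        · exact Or.inr (Or.inl h1)
        · obtain rfl : r = 0 := by omega
          exact Or.inr (Or.inr ⟨by omega, by rwa [Alloc.give_zero]⟩)

/-- Nothing of task `i` precedes a free slot. -/
def Stuck (T : Fin n → MTask) (i : Fin n) (A : Alloc n) : Prop :=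
  ∀ u, 1 ≤ u → u ≤ (T i).deadline → A.avail u = 0 ∨ sumBefore (A.y i) u = 0

/-- The state from which work of task `i` can still be moved to the slots `t, t - 1, …`: it is at
its bound after `t`. -/
structure Movable (T : Fin n → MTask) (i : Fin n) (t : ℕ) (A : Alloc n) : Prop where
  tight : ∀ u, 1 ≤ u → u ≤ (T i).deadline → A.y i u = (T i).bound ∨ A.avail u = 0 ∨
    sumBefore (A.y i) u = 0
  bound_after : ∀ u, t < u → u ≤ (T i).deadline → A.y i u = (T i).bound
  anti : ∀ x, x ≤ t → A.y i x < (T i).bound → ∀ v, 1 ≤ v → v + 1 < x →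
    A.avail (v + 1) + A.y i (v + 1) ≤ A.avail v + A.y i v

/-- The state in which task `i` is exactly served and its work remains to be moved to later slots;
`t` is the next slot to be considered. -/
structure Served (T : Fin n → MTask) (C : ℕ) (F : Finset (Fin n)) (i : Fin n) (t : ℕ)
    (A : Alloc n) : Prop where
  mid : Mid T C F i 0 A
  served : served T i A = (T i).demand
  anti : ∀ v, 1 ≤ v → v + 1 ≤ (T i).deadline → A.avail (v + 1) ≤ A.avail v
  state : Stuck T i A ∨ Movable T i t A

/-- The state in which the demand `Ω` of task `i` is missing; `t` is the next slot to be
considered. -/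
structure Unserved (T : Fin n → MTask) (C : ℕ) (F : Finset (Fin n)) (i : Fin n) (t Ω : ℕ)
    (A : Alloc n) : Prop where
  mid : Mid T C F i 0 A
  served : served T i A + Ω = (T i).demand
  avail_anti : ∀ v, 1 ≤ v → v + 1 ≤ (T i).deadline → A.avail (v + 1) ≤ A.avail v
  bound_after : ∀ u, t < u → u ≤ (T i).deadline → A.y i u = (T i).bound
  tight : ∀ u, 1 ≤ u → u ≤ t → A.y i u = (T i).bound ∨ A.avail u = 0
  anti : ∀ v, 1 ≤ v → v + 1 ≤ t → A.avail (v + 1) + A.y i (v + 1) ≤ A.avail v + A.y i v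

/-- The second phase serves `i` completely. A slot at which `i` stays below its bound is one where
the routine found no free slot any more; then no machine is left up to the deadline, and the
boundary condition (`hB`) says that nothing of `i` is missing. -/
theorem fullyAllocate_spec {pick : PickRule n} {S : List (Fin n)} (hi : i ∉ F)
    (hFS : ∀ j ∈ F, j ∈ S) (hFd : ∀ j ∈ F, (T i).deadline ≤ (T j).deadline)
    (hD : (T i).demand ≤ (T i).bound * (T i).deadline)
    (hB : ∀ A, Mid T C F i 0 A → (∀ v, 1 ≤ v → v ≤ (T i).deadline → A.avail v = 0) →
      (T i).demand ≤ served T i A)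
    (t Ω : ℕ) (A : Alloc n) (htd : t ≤ (T i).deadline)
    (h : (Ω = 0 ∧ Served T C F i (T i).deadline A) ∨ (0 < Ω ∧ Unserved T C F i t Ω A)) :
    Served T C F i (T i).deadline (fullyAllocate T pick S i t Ω A).val := by
  induction t generalizing Ω A with
  | zero =>
    rcases h with h | ⟨hΩ, h⟩
    · exact h.2
    · exfalso
      have h1 := h.served
      have : served T i A = (T i).bound * (T i).deadline := by
        rw [served, Finset.sum_congr rfl fun u hu => h.bound_after u (Finset.mem_Icc.1 hu).1
          (Finset.mem_Icc.1 hu).2]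
        simp [mul_comm]
      omega
  | succ t ih =>
    simp only [fullyAllocate, Timed.val_bind]
    rcases h with ⟨rfl, h⟩ | ⟨hΩ, h⟩
    · rw [if_pos rfl]; exact h
    rw [if_neg (by omega)]
    simp only [Timed.val_bind]
    have hk := fun u => h.mid.le_bound i u
    have hkt := hk (t + 1)
    obtain ⟨Δ, hΔ⟩ : ∃ Δ, min ((T i).bound - A.y i (t + 1)) Ω = Δ := ⟨_, rfl⟩
    split_ifs with hΔ0 <;> rw [val_step] at hΔ0
    · refine ih Ω A (by omega) (Or.inr ⟨hΩ, h.mid, h.served, h.avail_anti, ?_, ?_, ?_⟩)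
      · intro u hu1 hu2
        rcases Nat.eq_or_lt_of_le (show t + 1 ≤ u from hu1) with rfl | hu
        · omega
        · exact h.bound_after u hu hu2
      · exact fun u hu1 hu2 => h.tight u hu1 (by omega)
      · exact fun v hv1 hv2 => h.anti v hv1 (by omega)
    simp only [Timed.val_bind, val_step, hΔ]
    have hlt : A.y i (t + 1) < (T i).bound := by omega
    have hW0 : A.avail (t + 1) = 0 := by
      rcases h.tight (t + 1) (by omega) le_rfl with h1 | h1
      · omega
      · exact h1
    have hWz : ∀ v, t + 1 ≤ v → v ≤ (T i).deadline → A.avail v = 0 := fun v hv1 hv2 => by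
      have := le_of_anti h.avail_anti (by omega) hv1 hv2
      omega
    have hinv : RoutineInv T C F i (t + 1) false Δ (A.y i) A := by
      refine ⟨h.mid.exempt _, rfl, fun v hv1 hv2 => hWz v (by omega) hv2,
        fun v hv1 hv2 => h.anti v hv1 (by omega), fun u hu1 hu2 hu3 _ => ?_, by omega, by simp⟩
      rcases h.tight u hu1 (by omega) with h1 | h1
      · exact h1
      · omega
    obtain ⟨R, hexit⟩ := routine_spec (pick := pick) hi hFS hFd htd
      (show Δ ≤ (T i).bound - A.y i (t + 1) by omega) Δ A hinv (by omega)
    generalize (routine pick S i (t + 1) Δ false Δ A).val = A' at R hexit ⊢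
    generalize hw : A'.avail (t + 1) = w
    have hwΔ := R.le
    have hrow := R.row
    set A₂ := A'.give i (t + 1) w with hA₂
    have hy : ∀ u, u ≠ t + 1 → A₂.y i u = A.y i u := fun u hu => by
      simp [hA₂, Alloc.give_y, hu, hrow]
    have hyt : A₂.y i (t + 1) = A.y i (t + 1) + w := by simp [hA₂, Alloc.give_y, hrow]
    have ha : ∀ u, u ≠ t + 1 → A₂.avail u = A'.avail u := fun u hu => by
      simp [hA₂, Alloc.give_avail, hu]
    have hat : A₂.avail (t + 1) = 0 := by simp [hA₂, Alloc.give_avail, hw]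
    have haz : ∀ u, t + 1 ≤ u → u ≤ (T i).deadline → A₂.avail u = 0 := fun u hu1 hu2 => by
      rcases Nat.eq_or_lt_of_le hu1 with rfl | hu
      · exact hat
      · rw [ha u (by omega)]; exact R.zero_after u hu hu2
    have hmid : Mid T C F i 0 A₂ :=
      (R.mid.give hi (by omega) htd (by omega) (by rw [hrow]; omega)).close hat 0
    have hserved : served T i A₂ = served T i A + w := by
      rw [hA₂, served_give (by omega) htd]
      simp only [served, hrow]
    have hs := h.served
    have htight : ∀ u, 1 ≤ u → u ≤ t → A₂.y i u = (T i).bound ∨ A₂.avail u = 0 := by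
      intro u hu1 hu2
      rw [hy u (by omega), ha u (by omega)]
      by_cases hu3 : 0 < A'.avail u
      · exact Or.inl (R.full u hu1 (by omega) hu3 (by simp))
      · exact Or.inr (by omega)
    have hanti : ∀ v, 1 ≤ v → v + 1 ≤ t →
        A₂.avail (v + 1) + A₂.y i (v + 1) ≤ A₂.avail v + A₂.y i v := by
      intro v hv1 hv2
      rw [hy v (by omega), ha v (by omega), hy (v + 1) (by omega), ha (v + 1) (by omega)]
      exact R.anti v hv1 (by omega)
    have hAanti : ∀ v, 1 ≤ v → v + 1 ≤ (T i).deadline → A₂.avail (v + 1) ≤ A₂.avail v := by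
      intro v hv1 hv2
      by_cases hvt : v + 1 ≤ t
      · refine avail_anti hanti (fun u hu1 hu2 => ?_) (hmid.le_bound i) v hv1 hvt
        exact (htight u hu1 hu2).imp_right Or.inl
      · rw [haz (v + 1) (by omega) hv2]; exact Nat.zero_le _
    rcases hexit with hex | hex | hex
    · by_cases hΩw : Ω - w = 0
      · refine ih _ _ (by omega) (Or.inl ⟨hΩw, hmid, by omega, hAanti, Or.inr ⟨?_, ?_, ?_⟩⟩)
        · intro u hu1 hu2
          by_cases hut : u ≤ t
          · exact (htight u hu1 hut).imp_right Or.inl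
          · exact Or.inr (Or.inl (haz u (by omega) hu2))
        · intro u hu1 hu2; omega
        · intro x hx1 hx2 v hv1 hv2
          have : x ≤ t + 1 := by
            by_contra hc
            rw [hy x (by omega), h.bound_after x (by omega) hx1] at hx2
            omega
          exact hanti v hv1 (by omega)
      · refine ih _ _ (by omega) (Or.inr ⟨by omega, hmid, by omega, hAanti, ?_, htight, hanti⟩)
        intro u hu1 hu2
        by_cases hut : u = t + 1
        · subst hut; rw [hyt]; omega
        · rw [hy u hut]; exact h.bound_after u (by omega) hu2
    · have hz : ∀ v, 1 ≤ v → v ≤ (T i).deadline → A₂.avail v = 0 := fun v hv1 hv2 => by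
        by_cases hvt : v ≤ t
        · rw [ha v (by omega)]; exact hex v hv1 (by omega)
        · exact haz v (by omega) hv2
      have := hB A₂ hmid hz
      exact ih _ _ (by omega) (Or.inl ⟨by omega, hmid, by omega, hAanti,
        Or.inl fun u hu1 hu2 => Or.inl (hz u hu1 hu2)⟩)
    · simp at hex

end

section

/-! ### Moving one task to later slots -/

variable {n : ℕ} {T : Fin n → MTask} {C : ℕ} {F : Finset (Fin n)} {i : Fin n} {t : ℕ}
  {A : Alloc n}

theorem releaseEarliest_zero (m s : ℕ) (A : Alloc n) : (releaseEarliest i m s 0 A).val = A := by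
  induction m generalizing s with
  | zero => rfl
  | succ m ih => simp [releaseEarliest, ih]

/-- Releasing `θ` machines at the earliest slots removes `θ` from all partial sums of the
allocation of `i` (with truncated subtraction). -/
theorem releaseEarliest_spec (hi : i ∉ F) (m s θ : ℕ) (A : Alloc n) (hs : 1 ≤ s)
    (hm : s + m ≤ (T i).deadline + 1) (h : Mid T C F i 0 A)
    (hfree : ∀ u, s ≤ u → u < s + m → ∑ v ∈ Finset.Ico s u, A.y i v < θ → 0 < A.avail u) :
    let A' := (releaseEarliest i m s θ A).val
    Mid T C F i 0 A' ∧
    (∀ u, A'.avail u + A'.y i u = A.avail u + A.y i u) ∧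
    (∀ u, u < s ∨ s + m ≤ u → A'.y i u = A.y i u) ∧
    ∀ u, s ≤ u → u ≤ s + m →
      ∑ v ∈ Finset.Ico s u, A'.y i v = (∑ v ∈ Finset.Ico s u, A.y i v) - θ := by
  induction m generalizing s θ A with
  | zero =>
    refine ⟨h, fun u => rfl, fun u _ => rfl, fun u h1 h2 => ?_⟩
    obtain rfl : u = s := by omega
    simp
  | succ m ih =>
    simp only [releaseEarliest, Timed.val_bind, val_step]
    generalize hr : min θ (A.y i s) = r
    have hy : ∀ u, u ≠ s → (A.take i s r).y i u = A.y i u := fun u hu => by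
      simp [Alloc.take_y, hu]
    have hys : (A.take i s r).y i s = A.y i s - r := by simp [Alloc.take_y]
    have ha : ∀ u, A.avail u ≤ (A.take i s r).avail u := fun u => by
      simp [Alloc.take_avail]
    have hsum : ∀ u, ∑ v ∈ Finset.Ico (s + 1) u, (A.take i s r).y i v =
        ∑ v ∈ Finset.Ico (s + 1) u, A.y i v := fun u =>
      Finset.sum_congr rfl fun v hv => hy v (by have := (Finset.mem_Ico.1 hv).1; omega)
    have hsplit : ∀ (f : ℕ → ℕ) u, s < u →
        ∑ v ∈ Finset.Ico s u, f v = f s + ∑ v ∈ Finset.Ico (s + 1) u, f v := fun f u hu =>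
      Finset.sum_eq_sum_Ico_succ_bot hu f
    obtain ⟨h1, h2, h3, h4⟩ := ih (s + 1) (θ - r) (A.take i s r) (by omega) (by omega)
      (h.take hi (by omega) (by omega) fun hr0 => hfree s le_rfl (by omega) (by simp; omega))
      (fun u hu1 hu2 hu3 => by
        rw [hsum] at hu3
        refine (hfree u (by omega) (by omega) ?_).trans_le (ha u)
        rw [hsplit _ _ (by omega)]
        omega)
    refine ⟨h1, fun u => ?_, fun u hu => ?_, fun u hu1 hu2 => ?_⟩
    · rw [h2 u]
      by_cases hu : u = s
      · subst hu
        simp only [Alloc.take_avail, if_true, hys]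
        omega
      · simp [Alloc.take_avail, hy u hu, hu]
    · rw [h3 u (by omega), hy u (by omega)]
    · rcases hu1.eq_or_lt with rfl | hu
      · simp
      · rw [hsplit _ _ hu, hsplit _ _ hu, h3 s (by omega), h4 u (by omega) (by omega), hys, hsum]
        omega

/-- The outcome of moving the work of task `i` to later slots: `i` is late at every free slot. -/
structure Finished (T : Fin n → MTask) (C : ℕ) (F : Finset (Fin n)) (i : Fin n)
    (A : Alloc n) : Prop where
  mid : Mid T C F i 0 A
  served : served T i A = (T i).demand
  anti : ∀ v, 1 ≤ v → v + 1 ≤ (T i).deadline → A.avail (v + 1) ≤ A.avail v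
  late : ∀ v, 1 ≤ v → v ≤ (T i).deadline → 0 < A.avail v →
    (∀ u, v ≤ u → u ≤ (T i).deadline → A.y i u = (T i).bound) ∨ sumBefore (A.y i) v = 0

theorem Served.finished (h : Served T C F i t A) (h0 : sumBefore (A.y i) t = 0) :
    Finished T C F i A := by
  refine ⟨h.mid, h.served, h.anti, fun v hv1 hv2 hv3 => ?_⟩
  rcases h.state with hs | hs
  · rcases hs v hv1 hv2 with h1 | h1
    · omega
    · exact Or.inr h1
  · by_cases hvt : v ≤ t
    · right
      have := sumBefore_mono (A.y i) hvt
      omega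
    · exact Or.inl fun u hu1 hu2 => hs.bound_after u (by omega) hu2

/-- In the third phase, either `i` reaches its bound at the slot considered, or the state becomes
`Stuck` and nothing changes any more; in both cases `i` is late at every free slot in the end. -/
theorem allocateRLM_spec {pick : PickRule n} {S : List (Fin n)} (hi : i ∉ F)
    (hFS : ∀ j ∈ F, j ∈ S) (hFd : ∀ j ∈ F, (T i).deadline ≤ (T j).deadline)
    (t : ℕ) (A : Alloc n) (htd : t ≤ (T i).deadline) (h : Served T C F i t A) :
    Finished T C F i (allocateRLM T pick S i t A).val := by
  induction t generalizing A with
  | zero => exact h.finished (by simp [sumBefore])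
  | succ t ih =>
    simp only [allocateRLM, Timed.val_bind]
    split_ifs with hp <;> rw [prefixSum_val] at hp
    · exact h.finished hp
    simp only [Timed.val_bind]
    have hk := fun u => h.mid.le_bound i u
    have hkt := hk (t + 1)
    obtain ⟨Δ, hΔ⟩ : ∃ Δ, min ((T i).bound - A.y i (t + 1)) (prefixSum (A.y i) t).val = Δ :=
      ⟨_, rfl⟩
    have hΔ' := hΔ
    rw [prefixSum_val] at hΔ'
    split_ifs with hΔ0 <;> rw [val_step, hΔ] at hΔ0
    · refine ih A (by omega) ⟨h.mid, h.served, h.anti, h.state.imp_right fun hs =>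
        ⟨hs.tight, fun u hu1 hu2 => ?_, fun x hx => hs.anti x (by omega)⟩⟩
      by_cases hut : u = t + 1
      · subst hut; omega
      · exact hs.bound_after u (by omega) hu2
    simp only [Timed.val_bind, val_step, hΔ]
    have hlt : A.y i (t + 1) < (T i).bound := by omega
    have hW0 : A.avail (t + 1) = 0 := by
      rcases h.state with hs | hs
      · rcases hs (t + 1) (by omega) htd with h1 | h1
        · exact h1
        · omega
      · rcases hs.tight (t + 1) (by omega) htd with h1 | h1 | h1
        · omega
        · exact h1
        · omega
    rcases h.state with hs | hs
    · rw [routine_eq_self fun v hv1 hv2 => hs v hv1 (by omega), hW0, Alloc.give_zero,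
        releaseEarliest_zero]
      exact ih A (by omega) ⟨h.mid, h.served, h.anti, Or.inl hs⟩
    have hWz : ∀ v, t + 1 ≤ v → v ≤ (T i).deadline → A.avail v = 0 := fun v hv1 hv2 => by
      have := le_of_anti h.anti (by omega) hv1 hv2
      omega
    have hinv : RoutineInv T C F i (t + 1) true Δ (A.y i) A := by
      refine ⟨h.mid.exempt _, rfl, fun v hv1 hv2 => hWz v (by omega) hv2,
        fun v hv1 hv2 => hs.anti (t + 1) le_rfl hlt v hv1 hv2, fun u hu1 hu2 hu3 hu4 => ?_,
        by omega, fun _ v hv1 hv2 hv3 => by omega⟩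
      have := hu4 rfl
      rcases hs.tight u hu1 (by omega) with h1 | h1 | h1
      · exact h1
      · omega
      · omega
    obtain ⟨R, hexit⟩ := routine_spec (pick := pick) hi hFS hFd htd
      (show Δ ≤ (T i).bound - A.y i (t + 1) by omega) Δ A hinv (by omega)
    generalize (routine pick S i (t + 1) Δ true Δ A).val = A' at R hexit ⊢
    generalize hθ : A'.avail (t + 1) = θ
    have hθΔ := R.le
    have hrow := R.row
    set A₁ := A'.give i (t + 1) θ with hA₁
    have hy₁ : ∀ u, u ≠ t + 1 → A₁.y i u = A.y i u := fun u hu => by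
      simp [hA₁, Alloc.give_y, hu, hrow]
    have hyt₁ : A₁.y i (t + 1) = A.y i (t + 1) + θ := by simp [hA₁, Alloc.give_y, hrow]
    have ha₁ : ∀ u, u ≠ t + 1 → A₁.avail u = A'.avail u := fun u hu => by
      simp [hA₁, Alloc.give_avail, hu]
    have hat₁ : A₁.avail (t + 1) = 0 := by simp [hA₁, Alloc.give_avail, hθ]
    have hsum₁ : ∀ u, u ≤ t + 1 → sumBefore (A₁.y i) u = sumBefore (A.y i) u := fun u hu =>
      Finset.sum_congr rfl fun v hv => hy₁ v (by have := (Finset.mem_Ico.1 hv).2; omega)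
    have hmid₁ : Mid T C F i 0 A₁ :=
      (R.mid.give hi (by omega) htd (by omega) (by rw [hrow]; omega)).close hat₁ 0
    have hserved₁ : Malleable.served T i A₁ = Malleable.served T i A + θ := by
      rw [hA₁, served_give (by omega) htd]
      simp only [Malleable.served, hrow]
    obtain ⟨hmid, hU, hout, hpre⟩ := releaseEarliest_spec hi t 1 θ A₁ le_rfl (by omega) hmid₁
      (fun u hu1 hu2 hu3 => by
        have h1 : sumBefore (A₁.y i) u < θ := hu3
        rw [hsum₁ u (by omega)] at h1
        rw [ha₁ u (by omega)]
        exact R.debt rfl u hu1 (by omega) (by omega))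
    generalize (releaseEarliest i t 1 θ A₁).val = A₂ at hmid hU hout hpre ⊢
    have hpre₂ : ∀ u, 1 ≤ u → u ≤ t + 1 →
        sumBefore (A₂.y i) u = sumBefore (A.y i) u - θ := fun u hu1 hu2 => by
      rw [← hsum₁ u hu2]
      exact hpre u hu1 (by omega)
    -- A slot before `t + 1` loses machines only if nothing of `i` is left before it.
    have hsame : ∀ u, 1 ≤ u → u ≤ t →
        (A₂.y i u = A.y i u ∧ A₂.avail u = A'.avail u) ∨ sumBefore (A₂.y i) u = 0 := by
      intro u hu1 hu2
      have h1 := hpre₂ u hu1 (by omega)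
      have h2 := hpre₂ (u + 1) (by omega) (by omega)
      rw [sumBefore_succ _ hu1, sumBefore_succ _ hu1] at h2
      have h3 := hU u
      rw [hy₁ u (by omega), ha₁ u (by omega)] at h3
      omega
    have hyt : A₂.y i (t + 1) = A.y i (t + 1) + θ := by rw [hout _ (by omega), hyt₁]
    have hyafter : ∀ u, t + 1 < u → A₂.y i u = A.y i u := fun u hu => by
      rw [hout u (by omega), hy₁ u (by omega)]
    have haz : ∀ u, t + 1 ≤ u → u ≤ (T i).deadline → A₂.avail u = 0 := fun u hu1 hu2 => by
      have h3 := hU u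
      rw [hout u (by omega)] at h3
      rcases Nat.eq_or_lt_of_le hu1 with rfl | hu
      · omega
      · rw [ha₁ u (by omega), R.zero_after u hu hu2] at h3
        omega
    have hserved : Malleable.served T i A₂ = (T i).demand := by
      have hcut : ∀ f : ℕ → ℕ, ∑ u ∈ Finset.Icc 1 (T i).deadline, f u =
          sumBefore f (t + 1) + ∑ u ∈ Finset.Ico (t + 1) ((T i).deadline + 1), f u := fun f => by
        have : Finset.Icc 1 (T i).deadline = Finset.Ico 1 ((T i).deadline + 1) := by
          ext; simp
        rw [this, sumBefore, Finset.sum_Ico_consecutive _ (by omega) (by omega)]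
      have h1 := hpre₂ (t + 1) (by omega) le_rfl
      have h2 := h.served
      have h3 : Malleable.served T i A₁ = _ := hcut (A₁.y i)
      have h4 : Malleable.served T i A₂ = _ := hcut (A₂.y i)
      have h5 : ∑ u ∈ Finset.Ico (t + 1) ((T i).deadline + 1), A₂.y i u =
          ∑ u ∈ Finset.Ico (t + 1) ((T i).deadline + 1), A₁.y i u :=
        Finset.sum_congr rfl fun u hu => hout u (by have := (Finset.mem_Ico.1 hu).1; omega)
      rw [hsum₁ _ le_rfl] at h3
      omega
    have htight : ∀ u, 1 ≤ u → u ≤ t →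
        A₂.y i u = (T i).bound ∨ A₂.avail u = 0 ∨ sumBefore (A₂.y i) u = 0 := by
      intro u hu1 hu2
      rcases hsame u hu1 hu2 with ⟨h1, h2⟩ | h1
      · rw [h1, h2]
        by_cases hu3 : 0 < A'.avail u
        · by_cases hu4 : 0 < sumBefore (A.y i) u
          · exact Or.inl (R.full u hu1 (by omega) hu3 fun _ => hu4)
          · have := hpre₂ u hu1 (by omega)
            exact Or.inr (Or.inr (by omega))
        · exact Or.inr (Or.inl (by omega))
      · exact Or.inr (Or.inr h1)
    have hanti : ∀ v, 1 ≤ v → v + 1 ≤ t →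
        A₂.avail (v + 1) + A₂.y i (v + 1) ≤ A₂.avail v + A₂.y i v := by
      intro v hv1 hv2
      rw [hU, hU, hy₁ v (by omega), ha₁ v (by omega), hy₁ (v + 1) (by omega),
        ha₁ (v + 1) (by omega)]
      exact R.anti v hv1 (by omega)
    have hAanti : ∀ v, 1 ≤ v → v + 1 ≤ (T i).deadline → A₂.avail (v + 1) ≤ A₂.avail v := by
      intro v hv1 hv2
      by_cases hvt : v + 1 ≤ t
      · exact avail_anti hanti htight (hmid.le_bound i) v hv1 hvt
      · rw [haz (v + 1) (by omega) hv2]; exact Nat.zero_le _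
    have hstuck : (∀ u, 1 ≤ u → u ≤ t → A'.avail u = 0 ∨ sumBefore (A₂.y i) u = 0) →
        Served T C F i t A₂ := fun hst => by
      refine ⟨hmid, hserved, hAanti, Or.inl fun u hu1 hu2 => ?_⟩
      by_cases hut : u ≤ t
      · rcases hsame u hu1 hut with ⟨-, h2⟩ | h1
        · rw [h2]; exact hst u hu1 hut
        · exact Or.inr h1
      · exact Or.inl (haz u (by omega) hu2)
    refine ih A₂ (by omega) ?_
    rcases hexit with hex | hex | ⟨-, t', ht', hz, hle⟩
    · by_cases hΔb : Δ = (T i).bound - A.y i (t + 1)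
      · refine ⟨hmid, hserved, hAanti, Or.inr ⟨fun u hu1 hu2 => ?_, fun u hu1 hu2 => ?_,
          fun x hx1 _ v hv1 hv2 => hanti v hv1 (by omega)⟩⟩
        · by_cases hut : u ≤ t
          · exact htight u hu1 hut
          · exact Or.inr (Or.inl (haz u (by omega) hu2))
        · by_cases hut : u = t + 1
          · subst hut; rw [hyt]; omega
          · rw [hyafter u (by omega)]; exact hs.bound_after u (by omega) hu2
      · -- All the work of `i` before `t + 1` has been moved.
        refine hstuck fun u hu1 hu2 => Or.inr ?_
        have h1 := hpre₂ (t + 1) (by omega) le_rfl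
        have h2 := sumBefore_mono (A₂.y i) (show u ≤ t + 1 by omega)
        omega
    · exact hstuck fun u hu1 hu2 => Or.inl (hex u hu1 (by omega))
    · refine hstuck fun u hu1 hu2 => ?_
      by_cases hut : u ≤ t'
      · right
        have h1 := hpre₂ u hu1 (by omega)
        have h2 := sumBefore_mono (A.y i) hut
        omega
      · exact Or.inl (hz u (by omega) (by omega))

/-! ### The schedule of latest deadline first -/

/-- Serving one more task keeps the invariant of latest deadline first. -/
theorem allocateB_spec (hn : 0 < n) {pick : PickRule n} {S : List (Fin n)} {cur : ℕ}
    (hS : BoundaryOK T C S.toFinset) (hi : i ∉ F) (hiS : i ∈ S) (hFS : ∀ j ∈ F, j ∈ S)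
    (hFd : ∀ j ∈ F, (T i).deadline ≤ (T j).deadline)
    (hFi : ∀ j ∈ S, (T i).deadline < (T j).deadline → j ∈ F) (hcur : (T i).deadline ≤ cur)
    (h : Good T C F cur A) :
    Good T C (insert i F) (T i).deadline (allocateB T pick S A i).val := by
  have hFS' : F ⊆ S.toFinset := fun j hj => List.mem_toFinset.2 (hFS j hj)
  have hy0 : ∀ u, A.y i u = 0 := fun u => by
    by_contra hc
    exact hi (h.support i u hc).1
  have hmid : Mid T C F i 0 A := by
    refine ⟨h.total, h.le_bound, fun j u hu => ?_, h.served, fun u _ hu => ?_,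
      fun v hv1 _ hv => h.late v hv1 hv⟩
    · obtain ⟨h1, h2⟩ := h.support j u hu
      exact ⟨Finset.mem_insert_of_mem h1, h2⟩
    · by_cases hu1 : 1 ≤ u
      · exact h.anti u hu1 (Or.inr hu)
      · have := (T i).deadline_pos
        omega
  have hVanti : ∀ v, 1 ≤ v → v + 1 ≤ (T i).deadline → A.avail (v + 1) ≤ A.avail v :=
    fun v hv1 hv2 => h.anti v hv1 (Or.inl (by omega))
  simp only [allocateB, Timed.val_bind]
  obtain ⟨u1, u2, u3, u4⟩ := fullyUtilize_spec hi A.avail (T i).deadline (T i).demand A le_rfl hmid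
    (by simp [served, hy0]) (fun u _ => hy0 u) (fun v => by simp [hy0]) (fun u h1 h2 => by omega)
  generalize (fullyUtilize T i (T i).deadline (T i).demand A).val = r at u1 u2 u3 u4 ⊢
  have hUanti : ∀ v, 1 ≤ v → v + 1 ≤ (T i).deadline →
      r.2.avail (v + 1) + r.2.y i (v + 1) ≤ r.2.avail v + r.2.y i v := fun v hv1 hv2 => by
    rw [u3, u3]; exact hVanti v hv1 hv2
  have htight : ∀ u, 1 ≤ u → u ≤ (T i).deadline → r.2.y i u = (T i).bound ∨ r.2.avail u = 0 ∨
      sumBefore (r.2.y i) u = 0 := fun u hu1 hu2 =>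
    (u4 u hu1 hu2).imp_right fun h => h.imp_right And.right
  have hAanti := avail_anti hUanti htight (u1.le_bound i)
  have h1 : Served T C F i (T i).deadline
      (fullyAllocate T pick S i (T i).deadline r.1 r.2).val := by
    refine fullyAllocate_spec hi hFS hFd
      (hS.demand_le hn i (List.mem_toFinset.2 hiS)) (fun A hA hz => ?_) _ _ _ le_rfl ?_
    · exact hA.demand_le hn hS (Nat.zero_le _) hi (List.mem_toFinset.2 hiS) hFS'
        (fun j hj => hFi j (List.mem_toFinset.1 hj)) hz
    · by_cases hr : r.1 = 0
      · exact Or.inl ⟨hr, u1, by omega, hAanti, Or.inr ⟨htight, fun u hu1 hu2 => by omega,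
          fun x hx1 _ v hv1 hv2 => hUanti v hv1 (by omega)⟩⟩
      · refine Or.inr ⟨by omega, u1, u2, hAanti, fun u hu1 hu2 => by omega, fun u hu1 hu2 => ?_,
          hUanti⟩
        rcases u4 u hu1 hu2 with h3 | h3 | h3
        · exact Or.inl h3
        · exact Or.inr h3
        · exact absurd h3.1 hr
  have h2 := allocateRLM_spec (pick := pick) hi hFS hFd _ _ le_rfl h1
  generalize (allocateRLM T pick S i (T i).deadline
    (fullyAllocate T pick S i (T i).deadline r.1 r.2).val).val = B at h2 ⊢
  refine ⟨h2.mid.total, h2.mid.le_bound, h2.mid.support, fun j hj => ?_, fun u hu1 hu2 => ?_,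
    fun v hv1 hv j hj => ?_⟩
  · rcases Finset.mem_insert.1 hj with rfl | hj
    · exact h2.served
    · exact h2.mid.served j hj
  · by_cases hu : u + 1 ≤ (T i).deadline
    · exact h2.anti u hu1 hu
    · have hnd : ¬ IsDeadline T u := hu2.resolve_left hu
      have : u ≠ (T i).deadline := by rintro rfl; exact hnd ⟨i, rfl⟩
      exact h2.mid.anti u (by omega) hnd
  · rcases Finset.mem_insert.1 hj with rfl | hj
    · by_cases hvd : v ≤ (T j).deadline
      · refine (h2.late v hv1 hvd hv).imp_right fun h0 u hu => ?_
        by_contra hc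
        exact hc (eq_zero_of_sumBefore h0 (h2.mid.support j u hc).2.1 hu)
      · exact Or.inl fun u hu1 hu2 => by omega
    · exact h2.mid.late v hv1 (by omega) hv j hj

theorem allocateB_foldl_spec (hn : 0 < n) {pick : PickRule n} {S : List (Fin n)}
    (hS : BoundaryOK T C S.toFinset) (l : List (Fin n)) (F : Finset (Fin n)) {cur : ℕ}
    (hl : l.Nodup) (hsort : l.Pairwise fun i j => (T j).deadline ≤ (T i).deadline)
    (hmem : ∀ j, j ∈ S ↔ j ∈ F ∨ j ∈ l) (hdisj : ∀ j ∈ l, j ∉ F)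
    (hF : ∀ j ∈ F, ∀ i ∈ l, (T i).deadline ≤ (T j).deadline)
    (hcur : ∀ i ∈ l, (T i).deadline ≤ cur) {A : Alloc n} (h : Good T C F cur A) :
    ∃ cur', Good T C S.toFinset cur' (l.foldl (fun A i => (allocateB T pick S A i).val) A) := by
  induction l generalizing F cur A with
  | nil =>
    refine ⟨cur, ?_⟩
    have : S.toFinset = F := by ext j; simp [hmem]
    rw [this]; exact h
  | cons i l ih =>
    rw [List.nodup_cons] at hl
    rw [List.pairwise_cons] at hsort
    have hg := allocateB_spec (pick := pick) hn hS (hdisj i (by simp))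
      ((hmem i).2 (Or.inr (by simp))) (fun j hj => (hmem j).2 (Or.inl hj))
      (fun j hj => hF j hj i (by simp)) (fun j hj hlt => ?_) (hcur i (by simp)) h
    · refine ih (insert i F) hl.2 hsort.2 (fun j => ?_) (fun j hj => ?_) (fun j hj i' hi' => ?_)
        (fun j hj => hsort.1 j hj) hg
      · rw [hmem, Finset.mem_insert, List.mem_cons]; tauto
      · rw [Finset.mem_insert, not_or]
        refine ⟨?_, hdisj j (by simp [hj])⟩
        rintro rfl
        exact hl.1 hj
      · rcases Finset.mem_insert.1 hj with rfl | hj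
        · exact hsort.1 i' hi'
        · exact hF j hj i' (by simp [hi'])
    · rcases (hmem j).1 hj with h1 | h1
      · exact h1
      · rcases List.mem_cons.1 h1 with rfl | h1
        · omega
        · have := hsort.1 j h1
          omega

/-- The tasks of `S` in the order in which they are treated. -/
def ldfOrder (T : Fin n → MTask) (S : List (Fin n)) (taus : List ℕ) : List (Fin n) :=
  taus.flatMap fun τ => S.filter fun i => (T i).deadline = τ

theorem mem_ldfOrder {S : List (Fin n)} {taus : List ℕ} {j : Fin n} :
    j ∈ ldfOrder T S taus ↔ j ∈ S ∧ (T j).deadline ∈ taus := by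
  simp [ldfOrder, and_comm]

theorem ldfOrder_sorted {S : List (Fin n)} (hS : S.Nodup) {taus : List ℕ}
    (ht : taus.Pairwise (· > ·)) : (ldfOrder T S taus).Nodup ∧
      (ldfOrder T S taus).Pairwise fun i j => (T j).deadline ≤ (T i).deadline := by
  induction taus with
  | nil => simp [ldfOrder]
  | cons τ taus ih =>
    rw [List.pairwise_cons] at ht
    obtain ⟨h1, h2⟩ := ih ht.2
    have heq : ldfOrder T S (τ :: taus) =
        (S.filter fun i => (T i).deadline = τ) ++ ldfOrder T S taus := by
      simp [ldfOrder]
    have hlt : ∀ j ∈ ldfOrder T S taus, (T j).deadline < τ := fun j hj =>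
      ht.1 _ (mem_ldfOrder.1 hj).2
    rw [heq]
    constructor
    · refine List.Nodup.append (hS.filter _) h1 fun j hj1 hj2 => ?_
      have := hlt j hj2
      have := (List.mem_filter.1 hj1).2
      simp only [decide_eq_true_eq] at this
      omega
    · refine List.pairwise_append.2 ⟨?_, h2, fun i hi j hj => ?_⟩
      · refine List.pairwise_of_forall_mem_list fun i hi j hj => ?_
        simp only [List.mem_filter, decide_eq_true_eq] at hi hj
        omega
      · have := hlt j hj
        simp only [List.mem_filter, decide_eq_true_eq] at hi
        omega

theorem ldf_val (C : ℕ) (pick : PickRule n) (S : List (Fin n)) :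
    (ldf T C pick S).val = (ldfOrder T S (deadlines T).val).foldl
      (fun A i => (allocateB T pick S A i).val) ⟨fun _ _ => 0, fun _ => C⟩ := by
  simp only [ldf, Timed.val_bind, Timed.val_foldlM, withDeadline_val, ldfOrder,
    List.foldl_flatMap]

/-- Latest deadline first completes every set of tasks that satisfies the boundary condition. -/
theorem ldf_feasible (hn : 0 < n) {pick : PickRule n} {S : List (Fin n)} (hnd : S.Nodup)
    (hS : BoundaryOK T C S.toFinset) : IsFeasible T C S.toFinset (ldf T C pick S).val.y := by
  obtain ⟨h1, h2⟩ := ldfOrder_sorted (T := T) hnd (deadlines_pairwise T)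
  have h0 : Good T C ∅ (horizon T) ⟨fun _ _ => 0, fun _ => C⟩ :=
    ⟨by simp, by simp, by simp, by simp, by simp, by simp⟩
  have hmem : ∀ j, j ∈ S ↔ j ∈ (∅ : Finset (Fin n)) ∨ j ∈ ldfOrder T S (deadlines T).val := by
    simp [mem_ldfOrder, mem_deadlines, IsDeadline]
  obtain ⟨cur, h⟩ := allocateB_foldl_spec (pick := pick) hn hS (ldfOrder T S (deadlines T).val) ∅
    h1 h2 hmem (by simp) (by simp) (fun i _ => deadline_le_horizon T i) h0
  rw [← ldf_val] at h
  refine ⟨h.le_bound, h.support, fun i hi => (h.served i hi).ge, fun t => ?_⟩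
  have := h.total t
  omega

end

section

/-! ### The number of steps of the dynamic program -/

variable {n : ℕ} {T : Fin n → MTask}

theorem numDeadlines_le_horizon : numDeadlines T ≤ horizon T := by
  obtain ⟨mark, -, h⟩ := deadlines_val_eq T
  rw [← deadlines_length, h, List.length_reverse]
  exact (List.length_filter_le _ _).trans (by simp)

theorem deadlines_steps_le : (deadlines T).steps ≤ 2 * n + 2 * horizon T + 1 := by
  have hd : ((List.finRange n).foldlM (fun m i => step (max m (T i).deadline)) 0).val =
      horizon T := by
    simp [Timed.val_foldlM, foldl_max_eq_sup, horizon, List.toFinset_finRange]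
  simp only [deadlines, Timed.steps_bind, hd, steps_tick]
  have h1 := Timed.steps_foldlM_le (fun m i => step (max m (T i).deadline)) 1 (List.finRange n)
    (fun _ _ _ => le_rfl) 0
  have h2 := Timed.steps_foldlM_le
    (fun (b : ℕ → Bool) i => step (Function.update b (T i).deadline true)) 1 (List.finRange n)
    (fun _ _ _ => le_rfl) (fun _ => false)
  have h3 := fun mark : ℕ → Bool => Timed.steps_foldlM_le
    (fun (l : List ℕ) t => step (if mark (t + 1) then (t + 1) :: l else l)) 1
    (List.range (horizon T)) (fun _ _ _ => le_rfl) []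
  simp only [List.length_finRange, List.length_range, mul_one] at h1 h2 h3
  have h4 := h3 ((List.finRange n).foldlM
    (fun (b : ℕ → Bool) i => step (Function.update b (T i).deadline true)) (fun _ => false)).val
  omega

theorem segments_steps (l : List ℕ) : (segments l).steps = l.length + 1 := by
  induction l with
  | nil => rfl
  | cons a l ih => simp [segments, ih]

theorem contributions_steps (x : MTask) (segs : List Seg) :
    (contributions x segs).steps = segs.length + 1 := by
  induction segs with
  | nil => rfl
  | cons s segs ih => simp [contributions, ih]

theorem addLists_steps_le (l l' : List ℕ) : (addLists l l').steps ≤ l'.length + 1 := by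
  induction l' generalizing l with
  | nil => cases l <;> simp [addLists]
  | cons a l' ih =>
    cases l with
    | nil => simp [addLists]
    | cons b l => simpa [addLists] using ih l

theorem utilization_steps_le (C : ℕ) (segs : List Seg) (lams : List ℕ) (prev : ℕ) :
    (utilization C segs lams prev).steps ≤ 2 * segs.length + 1 := by
  induction segs generalizing lams prev with
  | nil => simp [utilization]
  | cons s segs ih =>
    cases lams with
    | nil => simp [utilization]
    | cons a lams =>
      have := ih lams (prev + min (a - prev) (C * s.width))
      simp only [utilization, Timed.steps_bind, val_step, steps_step, List.length_cons]
      omega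

theorem boundary_steps_le (C D last : ℕ) (segs : List Seg) (H : List ℕ) :
    (boundary C D last segs H).steps ≤ 2 * segs.length + 3 := by
  have key : ∀ prev, (boundaryFrom C D segs H prev).steps ≤ 2 * segs.length + 1 := by
    induction segs generalizing H with
    | nil => simp [boundaryFrom]
    | cons s segs ih =>
      intro prev
      cases H with
      | nil => simp [boundaryFrom]
      | cons a H =>
        have := ih H (prev + a)
        simp only [boundaryFrom, Timed.steps_bind, steps_step, List.length_cons]
        omega
  have := key 0
  simp only [boundary, Timed.steps_bind, steps_step]
  omega

theorem address_steps_le (C : ℕ) (segs : List Seg) (H : List ℕ) (a : ℕ) :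
    (address C segs H a).steps ≤ segs.length + 1 := by
  induction segs generalizing H a with
  | nil => simp [address]
  | cons s segs ih =>
    cases H with
    | nil => simp [address]
    | cons h H =>
      have := ih H (a * (C * s.width + 1) + h)
      simp only [address, Timed.steps_bind, val_step, steps_step, List.length_cons]
      omega

theorem insertEntry_steps (tie : TieRule n) (tbl : Table n) (a : ℕ) (e : Entry n) :
    (insertEntry tie tbl a e).steps = 1 := by
  unfold insertEntry
  split <;> rfl

theorem dpRound_steps_le (C : ℕ) (tie : TieRule n) (last : ℕ) (segs : List Seg) {N : ℕ}
    (hN : 0 < N) (old : Table n) (j : Fin n) :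
    (dpRound T C tie last segs N old j).steps ≤ 17 * (N * (segs.length + 1)) := by
  simp only [dpRound, Timed.steps_bind, steps_tick, contributions_steps]
  refine (Nat.add_le_add_left (Nat.add_le_add_left (Timed.steps_foldlM_le _
    (6 * segs.length + 9) _ (fun new c _ => ?_) _) _) _).trans ?_
  · simp only [Timed.steps_bind, steps_tick]
    cases old c with
    | none => simp only [steps_step]; omega
    | some e =>
      have h1 := addLists_steps_le e.lams (contributions (T j) segs).val
      rw [contributions_val, List.length_map] at h1
      simp only [Timed.steps_bind, val_step, steps_step, contributions_val]
      have h2 := utilization_steps_le C segs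
        (addLists e.lams (segs.map fun s => (T j).contribution s.start)).val 0
      have h3 := boundary_steps_le C (e.demand + (T j).demand) last segs (utilization C segs
        (addLists e.lams (segs.map fun s => (T j).contribution s.start)).val 0).val
      have h4 := address_steps_le C segs (utilization C segs
        (addLists e.lams (segs.map fun s => (T j).contribution s.start)).val 0).val 0
      split_ifs
      · simp only [Timed.steps_bind, insertEntry_steps]
        omega
      · simp only [steps_step]
        omega
  · rw [List.length_range]
    nlinarith [Nat.zero_le segs.length]

theorem bestEntry_steps_le (tie : TieRule n) (N : ℕ) (tbl : Table n) :
    (bestEntry tie N tbl).steps ≤ N := by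
  refine (Timed.steps_foldlM_le _ 1 _ (fun b c _ => ?_) none).trans (by simp)
  cases tbl c <;> cases b <;> exact le_rfl

theorem tableSize_steps_le (C : ℕ) (segs : List Seg) :
    (tableSize C segs).steps ≤ segs.length :=
  (Timed.steps_foldlM_le _ 1 segs (fun _ _ _ => le_rfl) 1).trans (by simp)

theorem dp_steps_le (hn : 0 < n) (C : ℕ) (tie : TieRule n) :
    (dp T C tie).steps ≤ 2 * n + 2 * horizon T +
      24 * (n * ((tableSize C (taskSegs T)).val * (numDeadlines T + 1))) := by
  have hN : 0 < (tableSize C (taskSegs T)).val := (Nat.zero_le _).trans_lt (cell_lt T C ∅)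
  simp only [dp, Timed.steps_bind, steps_tick,
    show (segments (deadlines T).val).val = taskSegs T from rfl]
  refine (Nat.add_le_add deadlines_steps_le (Nat.add_le_add (segments_steps _).le
    (Nat.add_le_add (tableSize_steps_le C _) (Nat.add_le_add le_rfl (Nat.add_le_add
    (Timed.steps_foldlM_le _ _ _ (fun old j _ => dpRound_steps_le C tie _ _ hN old j) _)
    (Nat.add_le_add (bestEntry_steps_le tie _ _) (?_ : _ ≤ 1))))))).trans ?_
  · split <;> exact le_rfl
  rw [deadlines_length, taskSegs_length, List.length_finRange]
  have h8 : (tableSize C (taskSegs T)).val * (numDeadlines T + 1) ≤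
      n * ((tableSize C (taskSegs T)).val * (numDeadlines T + 1)) := Nat.le_mul_of_pos_left _ hn
  have h9 : numDeadlines T + 1 ≤ (tableSize C (taskSegs T)).val * (numDeadlines T + 1) :=
    Nat.le_mul_of_pos_left _ hN
  have h10 : (tableSize C (taskSegs T)).val ≤
      (tableSize C (taskSegs T)).val * (numDeadlines T + 1) :=
    Nat.le_mul_of_pos_right _ (by omega)
  have h11 : n * (17 * ((tableSize C (taskSegs T)).val * (numDeadlines T + 1))) =
      17 * (n * ((tableSize C (taskSegs T)).val * (numDeadlines T + 1))) := by ring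
  omega

/-- `L! * ∏ w_m ≤ (∑ w_m) ^ L`. -/
theorem factorial_mul_prod_le (l : List ℕ) : l.length.factorial * l.prod ≤ l.sum ^ l.length := by
  induction l with
  | nil => simp
  | cons a l ih =>
    rw [List.length_cons, List.prod_cons, List.sum_cons, Nat.factorial_succ]
    have h1 : ∀ m, (m + 1) * (a * l.sum ^ m) ≤ (a + l.sum) ^ (m + 1) := by
      intro m
      induction m with
      | zero => simp
      | succ m ihm =>
        have h2 : l.sum ^ (m + 1) ≤ (a + l.sum) ^ (m + 1) := Nat.pow_le_pow_left (by omega) _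
        calc (m + 1 + 1) * (a * l.sum ^ (m + 1))
            = l.sum * ((m + 1) * (a * l.sum ^ m)) + a * l.sum ^ (m + 1) := by ring
          _ ≤ l.sum * (a + l.sum) ^ (m + 1) + a * (a + l.sum) ^ (m + 1) := by gcongr
          _ = (a + l.sum) ^ (m + 1 + 1) := by ring
    calc (l.length + 1) * l.length.factorial * (a * l.prod)
        = (l.length + 1) * (a * (l.length.factorial * l.prod)) := by ring
      _ ≤ (l.length + 1) * (a * l.sum ^ l.length) := by gcongr
      _ ≤ _ := h1 _

theorem succ_mul_two_pow_le (L : ℕ) : (L + 1) * 2 ^ L ≤ 6 * L.factorial := by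
  induction L with
  | zero => simp
  | succ L ih =>
    rcases Nat.lt_or_ge L 3 with h | h
    · interval_cases L <;> simp [Nat.factorial]
    · rw [Nat.factorial_succ, pow_succ]
      calc (L + 1 + 1) * (2 ^ L * 2) = (2 * (L + 2)) * 2 ^ L := by ring
        _ ≤ ((L + 1) * (L + 1)) * 2 ^ L := Nat.mul_le_mul_right _ (by nlinarith)
        _ = (L + 1) * ((L + 1) * 2 ^ L) := by ring
        _ ≤ (L + 1) * (6 * L.factorial) := by gcongr
        _ = _ := by ring

/-- The factor `L + 1` in the cost of treating one cell is absorbed, since the segments have total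
length `d` and hence `L! * ∏ w_m ≤ d ^ L`. -/
theorem tableSize_mul_le (hn : 0 < n) {C : ℕ} (hC : 0 < C) :
    (tableSize C (taskSegs T)).val * (numDeadlines T + 1) ≤
      6 * (horizon T ^ numDeadlines T * C ^ numDeadlines T) := by
  have hc := taskSegs_chain T hn
  have h1 := factorial_mul_prod_le ((taskSegs T).map Seg.width)
  rw [hc.sum_width, List.length_map, taskSegs_length] at h1
  have h2 : ∀ segs : List Seg, (∀ s ∈ segs, 0 < s.width) →
      (segs.map fun s => C * s.width + 1).prod ≤
        (2 * C) ^ segs.length * (segs.map Seg.width).prod := by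
    intro segs
    induction segs with
    | nil => simp
    | cons s segs ih =>
      intro hs
      have h3 := ih fun s' hs' => hs s' (by simp [hs'])
      have h4 : 1 ≤ C * s.width := Nat.mul_pos hC (hs s (by simp))
      simp only [List.map_cons, List.prod_cons, List.length_cons]
      calc _ ≤ (2 * C * s.width) * ((2 * C) ^ segs.length * (segs.map Seg.width).prod) := by
            refine Nat.mul_le_mul ?_ h3
            rw [mul_assoc]; omega
        _ = _ := by ring
  have h3 := h2 _ hc.width_pos
  rw [taskSegs_length] at h3
  rw [tableSize_val]
  generalize numDeadlines T = L at *
  generalize ((taskSegs T).map Seg.width).prod = P at *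
  refine Nat.le_of_mul_le_mul_left ?_ L.factorial_pos
  calc L.factorial * (((taskSegs T).map fun s => C * s.width + 1).prod * (L + 1))
      ≤ L.factorial * (((2 * C) ^ L * P) * (L + 1)) := by gcongr
    _ = ((L + 1) * 2 ^ L) * (C ^ L * (L.factorial * P)) := by rw [mul_pow]; ring
    _ ≤ (6 * L.factorial) * (C ^ L * horizon T ^ L) :=
        Nat.mul_le_mul (succ_mul_two_pow_le L) (Nat.mul_le_mul_left _ h1)
    _ = _ := by ring

/-! ### The number of steps of latest deadline first -/

theorem prefixSum_steps (f : ℕ → ℕ) (t : ℕ) : (prefixSum f t).steps = t + 1 := by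
  induction t with
  | zero => rfl
  | succ t ih => simp [prefixSum, ih]

theorem latestFree_steps_le (av : ℕ → ℕ) (t : ℕ) : (latestFree av t).steps ≤ t + 1 := by
  induction t with
  | zero => simp [latestFree]
  | succ t ih =>
    simp only [latestFree, Timed.steps_bind, steps_tick]
    split_ifs
    · simp only [steps_step]; omega
    · omega

theorem candidates_steps (A : Alloc n) (t t' : ℕ) (l : List (Fin n)) :
    (candidates A t t' l).steps = l.length + 1 := by
  induction l with
  | nil => rfl
  | cons a l ih => simp [candidates, ih]

theorem withDeadline_steps (τ : ℕ) (l : List (Fin n)) :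
    (withDeadline T τ l).steps = l.length + 1 := by
  induction l with
  | nil => rfl
  | cons a l ih => simp [withDeadline, ih]

theorem routine_steps_le (pick : PickRule n) (S : List (Fin n)) (i : Fin n) (t Δ : ℕ) (η : Bool)
    (fuel : ℕ) (A : Alloc n) :
    (routine pick S i t Δ η fuel A).steps ≤ fuel * (2 * t + S.length + 9) + 1 := by
  induction fuel generalizing A with
  | zero => simp [routine]
  | succ fuel ih =>
    rw [Nat.succ_mul]
    have hl := latestFree_steps_le A.avail (t - 1)
    simp only [routine, Timed.steps_bind, steps_tick]
    split_ifs
    · simp only [steps_step]; omega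
    simp only [Timed.steps_bind]
    cases hfree : (latestFree A.avail (t - 1)).val with
    | none => simp only [steps_step]; omega
    | some t' =>
      obtain ⟨g1, g2, -, -⟩ := latestFree_some hfree
      simp only [Timed.steps_bind, prefixSum_steps]
      split_ifs
      · simp only [steps_step]; omega
      simp only [Timed.steps_bind, candidates_steps]
      split_ifs with hne
      · simp only [Timed.steps_bind, steps_step, steps_tick, val_step]
        have := ih ((A.take (pick A t t' (candidates A t t' S).val hne).1 t 1).give
          (pick A t t' (candidates A t t' S).val hne).1 t' 1)
        omega
      · simp only [steps_step]; omega

theorem fullyUtilize_steps (i : Fin n) (t rem : ℕ) (A : Alloc n) :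
    (fullyUtilize T i t rem A).steps = 2 * t + 1 := by
  induction t generalizing rem A with
  | zero => rfl
  | succ t ih =>
    simp only [fullyUtilize, Timed.steps_bind, steps_step, steps_tick, ih]
    omega

theorem releaseEarliest_steps (i : Fin n) (m s θ : ℕ) (A : Alloc n) :
    (releaseEarliest i m s θ A).steps = 3 * m + 1 := by
  induction m generalizing s θ A with
  | zero => rfl
  | succ m ih =>
    simp only [releaseEarliest, Timed.steps_bind, steps_step, steps_tick, ih]
    omega

variable {d k : ℕ}

theorem fullyAllocate_steps_le (pick : PickRule n) (S : List (Fin n)) {i : Fin n}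
    (hk : (T i).bound ≤ k) (t Ω : ℕ) (htd : t ≤ d) (A : Alloc n) :
    (fullyAllocate T pick S i t Ω A).steps ≤ t * (k * (2 * d + S.length + 9) + 6) + 1 := by
  induction t generalizing Ω A with
  | zero => simp [fullyAllocate]
  | succ t ih =>
    rw [Nat.succ_mul]
    simp only [fullyAllocate, Timed.steps_bind, steps_tick]
    split_ifs
    · simp only [steps_step]; omega
    simp only [Timed.steps_bind, steps_step]
    have h1 := ih Ω (by omega) A
    split_ifs
    · omega
    simp only [Timed.steps_bind, steps_step, steps_tick, val_step]
    have h2 := routine_steps_le pick S i (t + 1) (min ((T i).bound - A.y i (t + 1)) Ω) false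
      (min ((T i).bound - A.y i (t + 1)) Ω) A
    have h3 : min ((T i).bound - A.y i (t + 1)) Ω * (2 * (t + 1) + S.length + 9) ≤
        k * (2 * d + S.length + 9) := Nat.mul_le_mul (by omega) (by omega)
    refine (Nat.add_le_add_left (Nat.add_le_add_left (Nat.add_le_add_left
      (Nat.add_le_add_left (Nat.add_le_add_left (ih _ (by omega) _) _) _) _) _) _).trans ?_
    omega

theorem allocateRLM_steps_le (pick : PickRule n) (S : List (Fin n)) {i : Fin n}
    (hk : (T i).bound ≤ k) (t : ℕ) (htd : t ≤ d) (A : Alloc n) :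
    (allocateRLM T pick S i t A).steps ≤
      t * (k * (2 * d + S.length + 9) + 4 * d + 8) + 1 := by
  induction t generalizing A with
  | zero => simp [allocateRLM]
  | succ t ih =>
    rw [Nat.succ_mul]
    simp only [allocateRLM, Timed.steps_bind, steps_tick, prefixSum_steps]
    split_ifs
    · simp only [steps_step]; omega
    simp only [Timed.steps_bind, steps_step]
    have h1 := ih (by omega) A
    split_ifs
    · omega
    simp only [Timed.steps_bind, steps_step, steps_tick, val_step, releaseEarliest_steps]
    have h2 := routine_steps_le pick S i (t + 1)
      (min ((T i).bound - A.y i (t + 1)) (prefixSum (A.y i) t).val) true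
      (min ((T i).bound - A.y i (t + 1)) (prefixSum (A.y i) t).val) A
    have h3 : min ((T i).bound - A.y i (t + 1)) (prefixSum (A.y i) t).val *
        (2 * (t + 1) + S.length + 9) ≤ k * (2 * d + S.length + 9) :=
      Nat.mul_le_mul (by omega) (by omega)
    refine (Nat.add_le_add_left (Nat.add_le_add_left (Nat.add_le_add_left
      (Nat.add_le_add_left (Nat.add_le_add_left (Nat.add_le_add_left
      (Nat.add_le_add_left (ih (by omega) _) _) _) _) _) _) _) _).trans ?_
    omega

theorem allocateB_steps_le (pick : PickRule n) (S : List (Fin n)) {i : Fin n}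
    (hk : (T i).bound ≤ k) (hd : (T i).deadline ≤ d) (A : Alloc n) :
    (allocateB T pick S A i).steps ≤
      d * (2 * (k * (2 * d + S.length + 9)) + 4 * d + 16) + 3 := by
  simp only [allocateB, Timed.steps_bind, fullyUtilize_steps]
  have h1 := fullyAllocate_steps_le pick S hk _
    (fullyUtilize T i (T i).deadline (T i).demand A).val.1 hd
    (fullyUtilize T i (T i).deadline (T i).demand A).val.2
  have h2 := allocateRLM_steps_le pick S hk _ hd (fullyAllocate T pick S i (T i).deadline
    (fullyUtilize T i (T i).deadline (T i).demand A).val.1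
    (fullyUtilize T i (T i).deadline (T i).demand A).val.2).val
  have h3 := Nat.mul_le_mul_right (k * (2 * d + S.length + 9) + 6) hd
  have h4 := Nat.mul_le_mul_right (k * (2 * d + S.length + 9) + 4 * d + 8) hd
  have h5 : d * (2 * (k * (2 * d + S.length + 9)) + 4 * d + 16) =
      d * (k * (2 * d + S.length + 9) + 6) + d * (k * (2 * d + S.length + 9) + 4 * d + 8) +
        2 * d := by ring
  omega

theorem ldf_steps_le (hn : 0 < n) (C : ℕ) (pick : PickRule n) {S : List (Fin n)}
    (hS : S.length ≤ n) (hd : ∀ i, (T i).deadline ≤ d) (hk : ∀ i, (T i).bound ≤ k) :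
    (ldf T C pick S).steps ≤
      (4 * d + 3 + d * (d * (2 * (k * (2 * d + 10)) + 4 * d + 16) + 6)) * n ^ 2 := by
  have hh : horizon T ≤ d := Finset.sup_le fun i _ => hd i
  have hL : numDeadlines T ≤ d := numDeadlines_le_horizon.trans hh
  have h1 := deadlines_steps_le (T := T)
  obtain ⟨Q, hQ⟩ : ∃ Q, d * (2 * (k * (2 * d + S.length + 9)) + 4 * d + 16) + 3 = Q := ⟨_, rfl⟩
  have hQn : Q ≤ (d * (2 * (k * (2 * d + 10)) + 4 * d + 16) + 3) * n := by
    rw [← hQ]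
    have : 2 * d + S.length + 9 ≤ (2 * d + 10) * n := by nlinarith
    calc _ ≤ d * (2 * (k * ((2 * d + 10) * n)) + 4 * d * n + 16 * n) + 3 * n := by
          have h2 : 4 * d ≤ 4 * d * n := Nat.le_mul_of_pos_right _ hn
          have h3 := Nat.mul_le_mul_left k this
          exact Nat.add_le_add (Nat.mul_le_mul_left _ (by omega)) (by omega)
      _ = _ := by ring
  have h2 := Timed.steps_foldlM_le (fun (A : Alloc n) τ => do
    let Sτ ← withDeadline T τ S
    Sτ.foldlM (fun (A : Alloc n) i => do
      tick 1
      allocateB T pick S A i) A) (n + 1 + n * (1 + Q)) (deadlines T).val (fun A τ _ => by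
        simp only [Timed.steps_bind, withDeadline_steps]
        refine Nat.add_le_add (by omega) ?_
        refine (Timed.steps_foldlM_le _ (1 + Q) _ (fun A i _ => ?_) A).trans
          (Nat.mul_le_mul_right _ ?_)
        · simp only [Timed.steps_bind, steps_tick]
          rw [← hQ]
          exact Nat.add_le_add_left (allocateB_steps_le pick S (hk i) (hd i) A) 1
        · rw [withDeadline_val]
          exact (List.length_filter_le _ _).trans hS) ⟨fun _ _ => 0, fun _ => C⟩
  rw [deadlines_length] at h2
  simp only [ldf, Timed.steps_bind, steps_tick]
  rw [deadlines_headD T hn]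
  have h3 := h2.trans (Nat.mul_le_mul_right _ hL)
  have hn1 : 1 ≤ n := hn
  have hn2 : n ≤ n ^ 2 := by nlinarith
  have h4 : d * (n + 1 + n * (1 + Q)) ≤
      d * (d * (2 * (k * (2 * d + 10)) + 4 * d + 16) + 6) * n ^ 2 := by
    calc d * (n + 1 + n * (1 + Q)) ≤ d * (n ^ 2 + n ^ 2 + (n ^ 2 + n * ((d * (2 * (k *
            (2 * d + 10)) + 4 * d + 16) + 3) * n))) := by
          refine Nat.mul_le_mul_left _ ?_
          have := Nat.mul_le_mul_left n hQn
          have h5 : n * (1 + Q) = n + n * Q := by ring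
          omega
      _ = _ := by ring
  have h5 : n * horizon T ≤ n ^ 2 * d := Nat.mul_le_mul hn2 hh
  have h6 : d ≤ d * n ^ 2 := Nat.le_mul_of_pos_right _ (by positivity)
  have h7 : (4 * d + 3 + d * (d * (2 * (k * (2 * d + 10)) + 4 * d + 16) + 6)) * n ^ 2 =
      4 * (d * n ^ 2) + 3 * n ^ 2 +
        d * (d * (2 * (k * (2 * d + 10)) + 4 * d + 16) + 6) * n ^ 2 := by ring
  have h8 : n ^ 2 * d = d * n ^ 2 := mul_comm _ _
  omega

end

end

end Malleable

theorem proposition5 :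
    ∃ K₀ : ℕ, ∀ dmax kmax : ℕ, ∃ K₁ : ℕ,
      ∀ (n C : ℕ) (_hn : 0 < n) (_hC : 0 < C) (T : Fin n → Malleable.MTask)
        (_hd : ∀ i, (T i).deadline ≤ dmax) (_hk : ∀ i, (T i).bound ≤ kmax)
        (tie : Malleable.TieRule n) (pick : Malleable.PickRule n)
        (S : List (Fin n)) (_hS : S.Perm (Malleable.dp T C tie).val),
        Malleable.IsOptimal T C S.toFinset (Malleable.ldf T C pick S).val.y ∧
        (Malleable.dp T C tie).steps + (Malleable.ldf T C pick S).steps ≤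
          max (K₀ * (n * Malleable.horizon T ^ Malleable.numDeadlines T *
                C ^ Malleable.numDeadlines T))
            (K₁ * n ^ 2) := by
  refine ⟨2 * 144, fun d k => ⟨2 * (2 + 2 * d + (4 * d + 3 + d * (d * (2 * (k * (2 * d + 10)) +
    4 * d + 16) + 6))), ?_⟩⟩
  intro n C hn hC T hd hk tie pick S hS
  obtain ⟨h1, h2, h3⟩ := Malleable.dp_spec (T := T) hn C tie
  have hnd : S.Nodup := hS.nodup_iff.2 h1
  have hfin : S.toFinset = (Malleable.dp T C tie).val.toFinset := List.toFinset_eq_of_perm _ _ hS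
  rw [← hfin] at h2 h3
  refine ⟨⟨Malleable.ldf_feasible hn hnd h2, h3⟩, ?_⟩
  have hlen : S.length ≤ n := by simpa using hnd.length_le_card
  have s1 := Malleable.dp_steps_le (T := T) hn C tie
  have s2 := Nat.mul_le_mul_left n (Malleable.tableSize_mul_le (T := T) hn hC)
  have s3 := Malleable.ldf_steps_le hn C pick hlen hd hk
  have s4 : n * (6 * (Malleable.horizon T ^ Malleable.numDeadlines T *
      C ^ Malleable.numDeadlines T)) = 6 * (n * Malleable.horizon T ^ Malleable.numDeadlines T *
      C ^ Malleable.numDeadlines T) := by ring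
  rw [s4] at s2
  have hh : Malleable.horizon T ≤ d := Finset.sup_le fun i _ => hd i
  have hn2 : n ≤ n ^ 2 := by nlinarith
  have s5 : d ≤ d * n ^ 2 := Nat.le_mul_of_pos_right _ (by positivity)
  generalize (4 * d + 3 + d * (d * (2 * (k * (2 * d + 10)) + 4 * d + 16) + 6)) = K at s3 ⊢
  have s6 : 2 * (2 + 2 * d + K) * n ^ 2 = 2 * (2 * n ^ 2 + 2 * (d * n ^ 2) + K * n ^ 2) := by ring
  rw [s6]
  omega
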